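/- Let $-\infty\le\alpha<\beta\le\infty$, $\mathcal I=\,]\alpha,\beta[$, and let $b,\sigma,r:\mathcal I\to\mathbb R$ be Borel measurable with $\sigma^2>0$ on $\mathcal I$, $r\ge r_0$ on $\mathcal I$ for some constant $r_0>0$, and, for all $\alpha<c<d<\beta$, $$\int_c^d\frac{1+|b(s)|}{\sigma^2(s)}\,ds<\infty,\qquad \sup_{[c,d]}\sigma^2<\infty,\qquad \int_c^d\frac{r(s)}{\sigma^2(s)}\,ds<\infty .$$ Let $\phi,\psi:\mathcal I\to\,]0,\infty[$ be $C^1$ functions with locally absolutely continuous derivatives, $\phi'<0<\psi'$ on $\mathcal I$, each solving $\tfrac12\sigma^2f''+bf'-rf=0$ Lebesgue-a.e. on $\mathcal I$. Put $\mathcal W=\phi\psi'-\phi'\psi$, $\Phi=\phi/(\sigma^2\mathcal W)$ and $\Psi=\psi/(\sigma^2\mathcal W)$. Let $g:\mathcal I\to\mathbb R$ be a difference of two convex functions, with left-hand derivative $g'_-$ and second distributional derivative $g''(dx)$ (a signed measure), and define the signed measure $$\mathcal Lg(dx)=\tfrac12\sigma^2(x)\,g''(dx)+b(x)g'_-(x)\,dx-r(x)g(x)\,dx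 ,$$ with total variation $|\mathcal Lg|$. Assume that $\int_{]\alpha,\gamma[}\Psi\,d|\mathcal Lg|+\int_{[\gamma,\beta[}\Phi\,d|\mathcal Lg|<\infty$ for all $\gamma\in\mathcal I$, and that $\lim_{x\downarrow\alpha}|g(x)|/\phi(x)=\lim_{x\uparrow\beta}|g(x)|/\psi(x)=0$. Let $x_l\le x_r$ be points of $\mathcal I$ and $\mathcal E=\,]\alpha,x_l[\,\cup\,]x_r,\beta[$. Assume: 1. on $\mathcal E$ the measure $\mathcal Lg$ has no atoms and $-\mathcal Lg$ is a positive measure, which gives strictly positive mass to every nonempty open interval contained in $\mathcal E$; 2. $g/\phi$ has a stationary point $x_\phi\in\,]\alpha,x_l]$ and $g/\psi$ has a stationary point $x_\psi\in[x_r,\beta[$ (the derivative exists there and is $0$); 3. the following limits, taken in $[-\infty,\infty]$, exist and satisfy $$\lim_{x\downarrow\alpha}\frac{g(x)}{\psi(x)}>\frac{g(x_\psi)}{\psi(x_\psi)}\qquad\text{and}\qquad\lim_{x\uparrow\beta}\frac{g(x)}{\phi(x)}>\frac{g(x_\phi)}{\phi(x_\phi)} .$$ For $y<z$ in $\mathcal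 I$ and $f\in\{\phi,\psi\}$ put $$q_f^{\mathrm o}(y,z)=\int_{]y,z[}\frac{2f(s)}{\sigma^2(s)\mathcal W(s)}\,\mathcal Lg(ds),\qquad q_f^{\mathrm c}(y,z)=\int_{[y,z]}\frac{2f(s)}{\sigma^2(s)\mathcal W(s)}\,\mathcal Lg(ds).$$ Then among all pairs $a<b$ of points of $\mathcal E$ there is exactly one such that $$q_\phi^{\mathrm o}(a,b)\ge0,\quad q_\phi^{\mathrm c}(a,b)\le0,\quad q_\psi^{\mathrm o}(a,b)\ge0,\quad q_\psi^{\mathrm c}(a,b)\le0,$$ and for this pair $\alpha<a<x_l$ and $x_r<b<\beta$. -/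

import Mathlib

open Set Filter Topology MeasureTheory
open scoped ENNReal

noncomputable section

namespace Straddle

/-- The state space `]α, β[`, an open interval of `ℝ` whose end points may be infinite. -/
def interval (α β : EReal) : Set ℝ := {x : ℝ | α < (x : EReal) ∧ (x : EReal) < β}

/-- The filter `x ↓ α`; it is `atBot` if `α = -∞`. -/
def downTo (α : EReal) : Filter ℝ := Filter.comap (fun x : ℝ => (x : EReal)) (𝓝[>] α)

/-- The filter `x ↑ β`; it is `atTop` if `β = ∞`. -/
def upTo (β : EReal) : Filter ℝ := Filter.comap (fun x : ℝ => (x : EReal)) (𝓝[<] β)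

/-- Standing assumption on the drift `b` and the volatility `σ` of the diffusion. -/
structure DiffusionCoefficients (α β : EReal) (b σ : ℝ → ℝ) : Prop where
  measurable_b : Measurable fun x : interval α β => b x
  measurable_σ : Measurable fun x : interval α β => σ x
  σ_sq_pos : ∀ x ∈ interval α β, 0 < σ x ^ 2
  integrable : ∀ c ∈ interval α β, ∀ d ∈ interval α β, c < d →
    IntegrableOn (fun s => (1 + |b s|) / σ s ^ 2) (Icc c d)
  bounded : ∀ c ∈ interval α β, ∀ d ∈ interval α β, c < d →
    BddAbove ((fun s => σ s ^ 2) '' Icc c d)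

/-- Standing assumption on the discount rate `r`. -/
structure DiscountRate (α β : EReal) (σ r : ℝ → ℝ) : Prop where
  measurable : Measurable fun x : interval α β => r x
  bounded_below : ∃ r₀ : ℝ, 0 < r₀ ∧ ∀ x ∈ interval α β, r₀ ≤ r x
  integrable : ∀ c ∈ interval α β, ∀ d ∈ interval α β, c < d →
    IntegrableOn (fun s => r s / σ s ^ 2) (Icc c d)

/-- `f` is `C¹` on `]α, β[` with a locally absolutely continuous derivative, and it solves
`½ σ² f'' + b f' - r f = 0` Lebesgue-almost everywhere there. -/
structure SolvesODE (α β : EReal) (b σ r : ℝ → ℝ) (f : ℝ → ℝ) : Prop where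
  contDiffOn : ContDiffOn ℝ 1 f (interval α β)
  absCont : ∀ c ∈ interval α β, ∀ d ∈ interval α β, c < d →
    AbsolutelyContinuousOnInterval (deriv f) c d
  ode : ∀ᵐ x : ℝ, x ∈ interval α β →
    1 / 2 * σ x ^ 2 * deriv (deriv f) x + b x * deriv f x - r x * f x = 0

/-- A positive decreasing solution `φ` and a positive increasing solution `ψ` of the ODE. -/
structure FundamentalSolutions (α β : EReal) (b σ r φ ψ : ℝ → ℝ) : Prop where
  solves_φ : SolvesODE α β b σ r φ
  solves_ψ : SolvesODE α β b σ r ψ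
  φ_pos : ∀ x ∈ interval α β, 0 < φ x
  φ_deriv_neg : ∀ x ∈ interval α β, deriv φ x < 0
  ψ_pos : ∀ x ∈ interval α β, 0 < ψ x
  ψ_deriv_pos : ∀ x ∈ interval α β, 0 < deriv ψ x

/-- The Wronskian `φ ψ' - φ' ψ`. -/
def wronskian (φ ψ : ℝ → ℝ) (x : ℝ) : ℝ := φ x * deriv ψ x - deriv φ x * ψ x

/-- The weight `f / (σ² 𝒲)`; it is `Φ` for `f = φ` and `Ψ` for `f = ψ`. -/
def weight (σ φ ψ f : ℝ → ℝ) (x : ℝ) : ℝ := f x / (σ x ^ 2 * wronskian φ ψ x)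

/-- Right-hand derivative. -/
def rightDeriv (F : ℝ → ℝ) (x : ℝ) : ℝ := derivWithin F (Ioi x) x

/-- Left-hand derivative. -/
def leftDeriv (F : ℝ → ℝ) (x : ℝ) : ℝ := derivWithin F (Iio x) x

instance ordConnected_interval (α β : EReal) : (interval α β).OrdConnected :=
  ⟨fun _ hx _ hy _ hz =>
    ⟨lt_of_lt_of_le hx.1 (EReal.coe_le_coe_iff.2 hz.1),
      lt_of_le_of_lt (EReal.coe_le_coe_iff.2 hz.2) hy.2⟩⟩

instance compactIcc_interval (α β : EReal) : CompactIccSpace (interval α β) := by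
  refine ⟨fun {a b} => ?_⟩
  rw [Subtype.isCompact_iff]
  have h : Subtype.val '' (Icc a b) = Icc (a : ℝ) (b : ℝ) := by
    ext x
    constructor
    · rintro ⟨y, hy, rfl⟩
      exact hy
    · intro hx
      exact ⟨⟨x, (ordConnected_interval α β).out a.2 b.2 hx⟩, hx, rfl⟩
  rw [h]
  exact isCompact_Icc

/-- The second distributional derivative of a convex function `F` on `]α, β[`: the
Lebesgue–Stieltjes measure on `]α, β[` of the right-hand derivative of `F`, which is monotone
(the value `0` is never used for convex `F`), viewed as a measure on `ℝ`. -/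
def secondDeriv (α β : EReal) (F : ℝ → ℝ) : Measure ℝ :=
  open scoped Classical in
  if h : Monotone fun x : interval α β => rightDeriv F x then
    (h.stieltjesFunction.measure).map Subtype.val
  else 0

section Lop

/- In this section `g = g₁ - g₂` with `g₁`, `g₂` convex on `]α, β[`. -/
variable (α β : EReal) (b σ r g₁ g₂ : ℝ → ℝ)

/-- A positive measure with respect to which all parts of `ℒg` are absolutely continuous. -/
def refMeasure : Measure ℝ :=
  secondDeriv α β g₁ + secondDeriv α β g₂ + volume.restrict (interval α β)

/-- The density, with respect to `refMeasure`, of the signed measure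
`ℒg(dx) = ½ σ²(x) g''(dx) + b(x) g'₋(x) dx - r(x) g(x) dx`, where `g = g₁ - g₂`. -/
def lopDensity (x : ℝ) : ℝ :=
  1 / 2 * σ x ^ 2 *
      (((secondDeriv α β g₁).rnDeriv (refMeasure α β g₁ g₂) x).toReal -
        ((secondDeriv α β g₂).rnDeriv (refMeasure α β g₁ g₂) x).toReal) +
    (b x * leftDeriv (fun y => g₁ y - g₂ y) x - r x * (g₁ x - g₂ x)) *
      ((volume.restrict (interval α β)).rnDeriv (refMeasure α β g₁ g₂) x).toReal

/-- The positive part `(ℒg)⁺` of the Jordan decomposition of `ℒg`. -/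
def lopPos : Measure ℝ :=
  (refMeasure α β g₁ g₂).withDensity fun x => ENNReal.ofReal (lopDensity α β b σ r g₁ g₂ x)

/-- The negative part `(ℒg)⁻` of the Jordan decomposition of `ℒg`. -/
def lopNeg : Measure ℝ :=
  (refMeasure α β g₁ g₂).withDensity fun x => ENNReal.ofReal (-lopDensity α β b σ r g₁ g₂ x)

/-- The total variation `|ℒg|`. -/
def lopVar : Measure ℝ := lopPos α β b σ r g₁ g₂ + lopNeg α β b σ r g₁ g₂

/-- The integral `∫_S h(s) ℒg(ds)`. -/
def lopIntegral (h : ℝ → ℝ) (S : Set ℝ) : ℝ :=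
  ∫ s in S, h s ∂(lopPos α β b σ r g₁ g₂) - ∫ s in S, h s ∂(lopNeg α β b σ r g₁ g₂)

/-- `g = g₁ - g₂` is a difference of convex functions on `]α, β[`, the measure `ℒg` is
`(φ, ψ)`-integrable, and `|g| / φ → 0` at `α`, `|g| / ψ → 0` at `β`. -/
structure Payoff (φ ψ : ℝ → ℝ) (g : ℝ → ℝ) : Prop where
  convex₁ : ConvexOn ℝ (interval α β) g₁
  convex₂ : ConvexOn ℝ (interval α β) g₂
  eq_sub : ∀ x ∈ interval α β, g x = g₁ x - g₂ x
  integrable : ∀ γ ∈ interval α β,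
    ∫⁻ s in interval α β ∩ Iio γ, ENNReal.ofReal (weight σ φ ψ ψ s) ∂(lopVar α β b σ r g₁ g₂) +
      ∫⁻ s in interval α β ∩ Ici γ, ENNReal.ofReal (weight σ φ ψ φ s)
        ∂(lopVar α β b σ r g₁ g₂) < ∞
  limit_α : Tendsto (fun x => |g x| / φ x) (downTo α) (𝓝 0)
  limit_β : Tendsto (fun x => |g x| / ψ x) (upTo β) (𝓝 0)

/-- `q_f^o(y, z)`, the integral of `2 f / (σ² 𝒲)` over `]y, z[` against `ℒg`
(used for `f = φ` and `f = ψ`). -/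
def qOpen (φ ψ f : ℝ → ℝ) (y z : ℝ) : ℝ :=
  lopIntegral α β b σ r g₁ g₂ (fun s => 2 * weight σ φ ψ f s) (Ioo y z)

/-- `q_f^c(y, z)`, the integral of `2 f / (σ² 𝒲)` over `[y, z]` against `ℒg`
(used for `f = φ` and `f = ψ`). -/
def qClosed (φ ψ f : ℝ → ℝ) (y z : ℝ) : ℝ :=
  lopIntegral α β b σ r g₁ g₂ (fun s => 2 * weight σ φ ψ f s) (Icc y z)

/-- The system of integral inequalities for the two free boundaries. -/
def BoundarySystem (φ ψ : ℝ → ℝ) (y z : ℝ) : Prop :=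
  0 ≤ qOpen α β b σ r g₁ g₂ φ ψ φ y z ∧ qClosed α β b σ r g₁ g₂ φ ψ φ y z ≤ 0 ∧
    0 ≤ qOpen α β b σ r g₁ g₂ φ ψ ψ y z ∧ qClosed α β b σ r g₁ g₂ φ ψ ψ y z ≤ 0

end Lop

/-- The set `ℰ = ]α, x_l[ ∪ ]x_r, β[`. -/
def outer (α β : EReal) (xl xr : ℝ) : Set ℝ :=
  interval α β ∩ Iio xl ∪ interval α β ∩ Ioi xr

end Straddle

end

namespace Straddle

/-- Along a curve `x ↦ (A x, B x)`, the point `x` comes before `y`: the first coordinate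
increases, and the slope of the chord lies between `-ρ x` and `-ρ y`. -/
structure ChordRel (A B ρ : ℝ → ℝ) (x y : ℝ) : Prop where
  lt : A x < A y
  ratio_lt : ρ y < ρ x
  ratio_pos : 0 < ρ y
  lower : ρ y * (A y - A x) ≤ B x - B y
  upper : B x - B y ≤ ρ x * (A y - A x)

namespace ChordRel

variable {A B ρ : ℝ → ℝ} {x y : ℝ}

lemma ratio_pos' (h : ChordRel A B ρ x y) : 0 < ρ x := h.ratio_pos.trans h.ratio_lt

lemma snd_lt (h : ChordRel A B ρ x y) : B y < B x := by
  have := mul_pos h.ratio_pos (sub_pos.2 h.lt)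
  linarith [h.lower]

lemma swap (h : ChordRel A B ρ x y) : ChordRel B A (fun t => (ρ t)⁻¹) y x where
  lt := h.snd_lt
  ratio_lt := inv_strictAnti₀ h.ratio_pos h.ratio_lt
  ratio_pos := inv_pos.2 h.ratio_pos'
  lower := by
    rw [inv_mul_le_iff₀ h.ratio_pos']
    exact h.upper
  upper := by
    rw [le_inv_mul_iff₀ h.ratio_pos]
    exact h.lower

end ChordRel

section OneSided

variable {A B ρ : ℝ → ℝ} {S : Set ℝ} {l k : Filter ℝ} {p : ℝ}

lemma eventually_lt_snd_of_chordRel (hl : ∀ y ∈ S, ∀ᶠ x in l, x ∈ S ∧ ChordRel A B ρ x y)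
    (hA : Tendsto A l (𝓝 0)) {y c : ℝ} (hy : y ∈ S) (hc : c < B y + ρ y * A y) :
    ∀ᶠ x in l, c < B x := by
  have ht : Tendsto (fun x => B y + ρ y * (A y - A x)) l (𝓝 (B y + ρ y * (A y - 0))) :=
    ((hA.const_sub _).const_mul _).const_add _
  rw [sub_zero] at ht
  filter_upwards [ht.eventually_const_lt hc, hl y hy] with x hx hxy
  linarith [hxy.2.lower]

lemma tendsto_inv_ratio (hu : Tendsto (fun x => A x + (ρ x)⁻¹ * B x) l (𝓝 0)) {c : ℝ}
    (hc : 0 < c) (hρ : ∀ᶠ x in l, 0 < ρ x) (hv : ∀ᶠ x in l, c < B x + ρ x * A x) :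
    Tendsto (fun x => (ρ x)⁻¹) l (𝓝 0) := by
  have ht := hu.const_mul c⁻¹
  rw [mul_zero] at ht
  refine tendsto_of_tendsto_of_tendsto_of_le_of_le' tendsto_const_nhds ht
    (hρ.mono fun x hx => (inv_pos.2 hx).le) ?_
  filter_upwards [hρ, hv] with x hx hvx
  rw [le_inv_mul_iff₀ hc, ← div_eq_mul_inv, div_le_iff₀ hx, add_mul, inv_mul_eq_div,
    div_mul_cancel₀ _ hx.ne']
  linarith

variable [l.NeBot] [k.NeBot]

lemma snd_pos_of_chordRel (hk : ∀ y ∈ S, ∀ᶠ m in k, m ∈ S ∧ ChordRel A B ρ y m)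
    (hB : Tendsto B k (𝓝 0)) {y : ℝ} (hy : y ∈ S) : 0 < B y := by
  obtain ⟨m, hm, hym⟩ := (hk y hy).exists
  have h0 : 0 ≤ B m := le_of_tendsto hB ((hk m hm).mono fun x hx => hx.2.snd_lt.le)
  exact h0.trans_lt hym.snd_lt

lemma limit_pos_of_chordRel (hS : S.Nonempty)
    (hl : ∀ y ∈ S, ∀ᶠ x in l, x ∈ S ∧ ChordRel A B ρ x y)
    (hk : ∀ y ∈ S, ∀ᶠ m in k, m ∈ S ∧ ChordRel A B ρ y m)
    (hu : Tendsto (fun x => A x + (ρ x)⁻¹ * B x) l (𝓝 0))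
    (hA : Tendsto A k (𝓝 p)) (hB : Tendsto B k (𝓝 0)) : 0 < p := by
  have key : ∀ x ∈ S, ∀ y ∈ S, ChordRel A B ρ x y →
      A x + (ρ x)⁻¹ * B x < A y + (ρ y)⁻¹ * B y := by
    intro x hx y hy h
    have h1 := h.swap.lower
    have h2 := h.swap.ratio_lt
    have h3 := mul_lt_mul_of_pos_right h2 (snd_pos_of_chordRel hk hB hy)
    linarith
  have hnn : ∀ y ∈ S, 0 ≤ A y + (ρ y)⁻¹ * B y := fun y hy =>
    le_of_tendsto hu ((hl y hy).mono fun x hx => (key x hx.1 y hy hx.2).le)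
  obtain ⟨y, hy⟩ := hS
  obtain ⟨m, hm, hym⟩ := (hk y hy).exists
  have h1 : A m + (ρ m)⁻¹ * B m ≤ p := by
    have ht : Tendsto (fun t => A t + (ρ m)⁻¹ * B t) k (𝓝 (p + (ρ m)⁻¹ * 0)) :=
      hA.add (hB.const_mul _)
    rw [mul_zero, add_zero] at ht
    refine ge_of_tendsto ht ((hk m hm).mono fun t ht => ?_)
    have := ht.2.swap.lower
    linarith
  exact ((hnn y hy).trans_lt (key y hy m hm hym)).trans_le h1

lemma fst_pos_of_chordRel (hl : ∀ y ∈ S, ∀ᶠ x in l, x ∈ S ∧ ChordRel A B ρ x y)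
    (hu : Tendsto (fun x => A x + (ρ x)⁻¹ * B x) l (𝓝 0))
    (hρ : Tendsto (fun x => (ρ x)⁻¹) l (𝓝 0)) {y : ℝ} (hy : y ∈ S) : 0 < A y := by
  have hnn : ∀ y ∈ S, 0 ≤ A y := by
    intro y hy
    have ht : Tendsto (fun x => A y + (ρ x)⁻¹ * B y) l (𝓝 (A y + 0 * B y)) :=
      (hρ.mul_const _).const_add _
    rw [zero_mul, add_zero] at ht
    refine le_of_tendsto_of_tendsto hu ht ((hl y hy).mono fun x hx => ?_)
    have := hx.2.swap.lower
    linarith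
  obtain ⟨x, hx, hxy⟩ := (hl y hy).exists
  exact (hnn x hx).trans_lt hxy.lt

lemma tendsto_fst_of_chordRel (hS : S.Nonempty)
    (hl : ∀ y ∈ S, ∀ᶠ x in l, x ∈ S ∧ ChordRel A B ρ x y)
    (hu : Tendsto (fun x => A x + (ρ x)⁻¹ * B x) l (𝓝 0))
    (hρ : Tendsto (fun x => (ρ x)⁻¹) l (𝓝 0)) (hB : ∀ y ∈ S, 0 < B y) :
    Tendsto A l (𝓝 0) := by
  obtain ⟨y, hy⟩ := hS
  refine tendsto_of_tendsto_of_tendsto_of_le_of_le' tendsto_const_nhds hu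
    ((hl y hy).mono fun x hx => (fst_pos_of_chordRel hl hu hρ hx.1).le)
    ((hl y hy).mono fun x hx => ?_)
  have := mul_pos (inv_pos.2 hx.2.ratio_pos') (hB x hx.1)
  linarith

end OneSided

/-- Two curves `x ↦ (A x, B x)`, parametrised by the two ends of an interval, whose tangents have
slope `-ρ` with `ρ` strictly decreasing, cross exactly once. -/
theorem exists_unique_crossing {I : Set ℝ} (hI : I.OrdConnected) {A B ρ : ℝ → ℝ}
    {xl xr xφ xψ p q c d : ℝ} {lα lβ : Filter ℝ} [lα.NeBot] [lβ.NeBot]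
    (hlα : ∀ y ∈ I, ∀ᶠ x in lα, x ∈ I ∧ x < y) (hlβ : ∀ y ∈ I, ∀ᶠ x in lβ, x ∈ I ∧ y < x)
    (hρpos : ∀ x ∈ I, 0 < ρ x) (hρ : StrictAntiOn ρ I)
    (hL : ∀ x ∈ I, ∀ y ∈ I, x < y → y < xl → ChordRel A B ρ x y)
    (hR : ∀ x ∈ I, ∀ y ∈ I, xr < x → x < y → ChordRel A B ρ x y)
    (hAL : ContinuousOn A (I ∩ Iio xl)) (hBL : ContinuousOn B (I ∩ Iio xl))
    (hAR : ContinuousOn A (I ∩ Ioi xr))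
    (hxφ : xφ ∈ I) (hxψ : xψ ∈ I) (hlr : xl ≤ xr) (hφl : xφ ≤ xl) (hrψ : xr ≤ xψ)
    (hAφ : Tendsto A (𝓝[<] xφ) (𝓝 p)) (hBφ : Tendsto B (𝓝[<] xφ) (𝓝 0))
    (hAψ : Tendsto A (𝓝[>] xψ) (𝓝 0)) (hBψ : Tendsto B (𝓝[>] xψ) (𝓝 q))
    (hu : Tendsto (fun x => A x + (ρ x)⁻¹ * B x) lα (𝓝 0))
    (hv : Tendsto (fun x => B x + ρ x * A x) lβ (𝓝 0))
    (hc : q < c) (hcα : ∀ᶠ x in lα, c < B x + ρ x * A x)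
    (hd : p < d) (hdβ : ∀ᶠ x in lβ, d < A x + (ρ x)⁻¹ * B x) :
    ∃ a ∈ I, ∃ b ∈ I, a < xl ∧ xr < b ∧ A a = A b ∧ B a = B b ∧
      ∀ y ∈ I ∩ Iio xl ∪ I ∩ Ioi xr, ∀ z ∈ I ∩ Iio xl ∪ I ∩ Ioi xr, y < z →
        A y = A z → B y = B z → y = a ∧ z = b := by
  have hlS : ∀ y ∈ I ∩ Iio xφ, ∀ᶠ x in lα, x ∈ I ∩ Iio xφ ∧ ChordRel A B ρ x y :=
    fun y hy => (hlα y hy.1).mono fun x hx =>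
      ⟨⟨hx.1, hx.2.trans hy.2⟩, hL x hx.1 y hy.1 hx.2 (lt_of_lt_of_le hy.2 hφl)⟩
  have hlT : ∀ y ∈ I ∩ Ioi xψ, ∀ᶠ x in lβ,
      x ∈ I ∩ Ioi xψ ∧ ChordRel B A (fun t => (ρ t)⁻¹) x y :=
    fun y hy => (hlβ y hy.1).mono fun x hx =>
      ⟨⟨hx.1, lt_trans hy.2 hx.2⟩, (hR y hy.1 x hx.1 (lt_of_le_of_lt hrψ hy.2) hx.2).swap⟩
  have hkS : ∀ y ∈ I ∩ Iio xφ, ∀ᶠ m in 𝓝[<] xφ, m ∈ I ∩ Iio xφ ∧ ChordRel A B ρ y m := by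
    intro y hy
    filter_upwards [Ioo_mem_nhdsLT hy.2] with m hm
    have hmI : m ∈ I := hI.out hy.1 hxφ ⟨hm.1.le, hm.2.le⟩
    exact ⟨⟨hmI, hm.2⟩, hL y hy.1 m hmI hm.1 (hm.2.trans_le hφl)⟩
  have hkT : ∀ y ∈ I ∩ Ioi xψ, ∀ᶠ m in 𝓝[>] xψ,
      m ∈ I ∩ Ioi xψ ∧ ChordRel B A (fun t => (ρ t)⁻¹) y m := by
    intro y hy
    filter_upwards [Ioo_mem_nhdsGT hy.2] with m hm
    have hmI : m ∈ I := hI.out hxψ hy.1 ⟨hm.1.le, hm.2.le⟩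
    exact ⟨⟨hmI, hm.1⟩, (hR m hmI y hy.1 (hrψ.trans_lt hm.1) hm.2).swap⟩
  have hSne : (I ∩ Iio xφ).Nonempty := (hlα xφ hxφ).exists
  have hTne : (I ∩ Ioi xψ).Nonempty := (hlβ xψ hxψ).exists
  have hv' : Tendsto (fun x => B x + ((ρ x)⁻¹)⁻¹ * A x) lβ (𝓝 0) := by simpa using hv
  have hp : 0 < p := limit_pos_of_chordRel hSne hlS hkS hu hAφ hBφ
  have hq : 0 < q := limit_pos_of_chordRel hTne hlT hkT hv' hBψ hAψ
  have hρα : Tendsto (fun x => (ρ x)⁻¹) lα (𝓝 0) :=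
    tendsto_inv_ratio hu (hq.trans hc) ((hlα xφ hxφ).mono fun x hx => hρpos x hx.1) hcα
  have hρβ : Tendsto (fun x => ((ρ x)⁻¹)⁻¹) lβ (𝓝 0) :=
    tendsto_inv_ratio hv' (hp.trans hd)
      ((hlβ xφ hxφ).mono fun x hx => inv_pos.2 (hρpos x hx.1)) hdβ
  have hBS : ∀ y ∈ I ∩ Iio xφ, 0 < B y := fun y hy => snd_pos_of_chordRel hkS hBφ hy
  have hAT : ∀ y ∈ I ∩ Ioi xψ, 0 < A y := fun y hy => snd_pos_of_chordRel hkT hAψ hy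
  have hAS : ∀ y ∈ I ∩ Iio xφ, 0 < A y := fun y hy => fst_pos_of_chordRel hlS hu hρα hy
  have hBT : ∀ y ∈ I ∩ Ioi xψ, 0 < B y := fun y hy => fst_pos_of_chordRel hlT hv' hρβ hy
  have hA0 := tendsto_fst_of_chordRel hSne hlS hu hρα hBS
  have hB0 := tendsto_fst_of_chordRel hTne hlT hv' hρβ hAT
  have hBα : ∀ᶠ x in lα, q < B x := by
    obtain ⟨y, hy, hcy⟩ := (((hlα xφ hxφ).and hcα)).exists
    exact (eventually_lt_snd_of_chordRel hlS hA0 hy hcy).mono fun x hx => hc.trans hx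
  have hAβ : ∀ᶠ x in lβ, p < A x := by
    obtain ⟨y, hy, hdy⟩ := (((hlβ xψ hxψ).and hdβ)).exists
    exact (eventually_lt_snd_of_chordRel hlT hB0 hy hdy).mono fun x hx => hd.trans hx
  obtain ⟨zs, hzs, hpzs⟩ := ((hlβ xψ hxψ).and hAβ).exists
  -- the partner of `y` on the right branch
  have hpart : ∀ y ∈ I ∩ Iio xφ, ∃ z, z ∈ I ∩ Ioi xψ ∧ z ≤ zs ∧ A z = A y := by
    intro y hy
    have hAy := hAS y hy
    have hyp : A y < p := by
      obtain ⟨m, hm, hym⟩ := (hkS y hy).exists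
      exact hym.lt.trans_le (ge_of_tendsto hAφ ((hkS m hm).mono fun t ht => ht.2.lt.le))
    obtain ⟨w, hwA, hw⟩ := ((hAψ.eventually_lt_const hAy).and
      (eventually_mem_set.2 (Ioo_mem_nhdsGT hzs.2))).exists
    have hsub : Icc w zs ⊆ I ∩ Ioi xψ := fun t ht =>
      ⟨hI.out hxψ hzs.1 ⟨hw.1.le.trans ht.1, ht.2⟩, hw.1.trans_le ht.1⟩
    obtain ⟨z, hz, hzA⟩ := intermediate_value_Icc hw.2.le
      (hAR.mono fun t ht => ⟨(hsub ht).1, hrψ.trans_lt (hsub ht).2⟩)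
      ⟨hwA.le, (hyp.trans hpzs).le⟩
    exact ⟨z, hsub hz, hz.2, hzA⟩
  choose! Z hZT hZle hZA using hpart
  have hBlip : ∀ x ∈ I ∩ Ioi xψ, ∀ y ∈ I ∩ Ioi xψ, |B x - B y| ≤ ρ xψ * |A x - A y| := by
    have aux : ∀ x ∈ I ∩ Ioi xψ, ∀ y ∈ I ∩ Ioi xψ, x < y →
        |B x - B y| ≤ ρ xψ * |A x - A y| := by
      intro x hx y hy hxy
      have h := hR x hx.1 y hy.1 (hrψ.trans_lt hx.2) hxy
      rw [abs_of_pos (sub_pos.2 h.snd_lt), abs_sub_comm, abs_of_pos (sub_pos.2 h.lt)]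
      exact h.upper.trans (mul_le_mul_of_nonneg_right (hρ hxψ hx.1 hx.2).le
        (sub_pos.2 h.lt).le)
    intro x hx y hy
    rcases lt_trichotomy x y with h | rfl | h
    · exact aux x hx y hy h
    · simp
    · rw [abs_sub_comm, abs_sub_comm (A x)]
      exact aux y hy x hx h
  have hsubS : I ∩ Iio xφ ⊆ I ∩ Iio xl := fun t ht => ⟨ht.1, lt_of_lt_of_le ht.2 hφl⟩
  have hBZ : ContinuousOn (fun y => B (Z y)) (I ∩ Iio xφ) := by
    intro y hy
    have hAy : Tendsto (fun x => ρ xψ * |A x - A y|) (𝓝[I ∩ Iio xφ] y) (𝓝 0) := by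
      have h1 : Tendsto A (𝓝[I ∩ Iio xφ] y) (𝓝 (A y)) := (hAL.mono hsubS) y hy
      have := ((h1.sub_const (A y)).abs).const_mul (ρ xψ)
      simpa using this
    rw [ContinuousWithinAt, tendsto_iff_dist_tendsto_zero]
    refine squeeze_zero' (Eventually.of_forall fun _ => dist_nonneg) ?_ hAy
    filter_upwards [self_mem_nhdsWithin] with x hx
    have := hBlip _ (hZT x hx) _ (hZT y hy)
    rwa [hZA x hx, hZA y hy] at this
  obtain ⟨y₁, hy₁, hqy₁⟩ := ((hlα xφ hxφ).and hBα).exists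
  have hF₁ : B (Z y₁) < B y₁ := by
    have h1 : B (Z y₁) ≤ q := ge_of_tendsto hBψ
      ((hkT _ (hZT y₁ hy₁)).mono fun t ht => ht.2.lt.le)
    exact h1.trans_lt hqy₁
  obtain ⟨y₂, hy₂, hBy₂⟩ := ((eventually_mem_set.2 (Ioo_mem_nhdsLT hy₁.2)).and
    (hBφ.eventually_lt_const (hBT zs hzs))).exists
  have hIcc : Icc y₁ y₂ ⊆ I ∩ Iio xφ := fun t ht =>
    ⟨hI.out hy₁.1 hxφ ⟨ht.1, ht.2.trans hy₂.2.le⟩, ht.2.trans_lt hy₂.2⟩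
  have hy₂S : y₂ ∈ I ∩ Iio xφ := hIcc ⟨hy₂.1.le, le_rfl⟩
  have hF₂ : B y₂ < B (Z y₂) := by
    refine hBy₂.trans_le ?_
    rcases (hZle y₂ hy₂S).eq_or_lt with h | h
    · rw [h]
    · exact (hR _ (hZT y₂ hy₂S).1 zs hzs.1 (hrψ.trans_lt (hZT y₂ hy₂S).2) h).snd_lt.le
  obtain ⟨a, haI, ha⟩ := intermediate_value_Icc' hy₂.1.le
    (((hBL.mono hsubS).mono hIcc).sub (hBZ.mono hIcc))
    (show (0 : ℝ) ∈ Icc (B y₂ - B (Z y₂)) (B y₁ - B (Z y₁)) from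
      ⟨(sub_neg.2 hF₂).le, (sub_pos.2 hF₁).le⟩)
  have haS := hIcc haI
  have hbT := hZT a haS
  -- two crossings are impossible
  have huniq : ∀ y ∈ I, ∀ z ∈ I, ∀ y' ∈ I, ∀ z' ∈ I, y' < xl → xr < z → xr < z' →
      A y = A z → B y = B z → A y' = A z' → B y' = B z' → ¬ y < y' := by
    intro y hy z hz y' hy' z' hz' hy'l hzr hz'r h1 h2 h3 h4 hlt
    have h := hL y hy y' hy' hlt hy'l
    have hzz : z < z' := by
      by_contra! hle
      rcases hle.eq_or_lt with e | hlt'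
      · have := h.lt
        rw [h1, h3, e] at this
        exact lt_irrefl _ this
      · have := (hR z' hz' z hz hz'r hlt').lt
        rw [← h1, ← h3] at this
        exact lt_asymm this h.lt
    have h' := hR z hz z' hz' hzr hzz
    have hlow := h.lower
    have hup := h'.upper
    rw [← h1, ← h2, ← h3, ← h4] at hup
    have hρlt : ρ z < ρ y' := hρ hy' hz (hy'l.trans_le (hlr.trans hzr.le))
    have := mul_lt_mul_of_pos_right hρlt (sub_pos.2 h.lt)
    linarith
  have haxl : a < xl := lt_of_lt_of_le haS.2 hφl
  have hbxr : xr < Z a := hrψ.trans_lt hbT.2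
  have hAab : A a = A (Z a) := (hZA a haS).symm
  have hBab : B a = B (Z a) := sub_eq_zero.1 ha
  refine ⟨a, haS.1, Z a, hbT.1, haxl, hbxr, hAab, hBab, ?_⟩
  intro y hy z hz hyz h1 h2
  rcases hy with ⟨hy, hyl⟩ | ⟨hy, hyr⟩
  · rcases hz with ⟨hz, hzl⟩ | ⟨hz, hzr⟩
    · exact absurd h1 (hL y hy z hz hyz hzl).lt.ne
    · have hya : y = a := le_antisymm
        (not_lt.1 (huniq a haS.1 _ hbT.1 y hy z hz hyl hbxr hzr hAab hBab h1 h2))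
        (not_lt.1 (huniq y hy z hz a haS.1 _ hbT.1 haxl hzr hbxr h1 h2 hAab hBab))
      subst hya
      refine ⟨rfl, ?_⟩
      rw [hAab] at h1
      rcases lt_trichotomy z (Z y) with h | h | h
      · exact absurd h1.symm (hR z hz _ hbT.1 hzr h).lt.ne
      · exact h
      · exact absurd h1 (hR _ hbT.1 z hz hbxr h).lt.ne
  · have hzr : xr < z := lt_trans hyr hyz
    have hzI : z ∈ I := hz.elim (fun h => h.1) fun h => h.1
    exact absurd h1 (hR y hy z hzI hyr hyz).lt.ne

lemma isOpen_interval (α β : EReal) : IsOpen (interval α β) :=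
  (isOpen_Ioo (a := α) (b := β)).preimage continuous_coe_real_ereal

lemma measurableSet_interval (α β : EReal) : MeasurableSet (interval α β) :=
  (isOpen_interval α β).measurableSet

lemma Icc_subset_interval {α β : EReal} {x y : ℝ} (hx : x ∈ interval α β)
    (hy : y ∈ interval α β) : Icc x y ⊆ interval α β :=
  (ordConnected_interval α β).out hx hy

lemma uIcc_subset_interval {α β : EReal} {x y : ℝ} (hx : x ∈ interval α β)
    (hy : y ∈ interval α β) : uIcc x y ⊆ interval α β :=
  (ordConnected_interval α β).uIcc_subset hx hy

section EndFilters

variable {α β : EReal} {y : ℝ}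

lemma eventually_downTo (hy : y ∈ interval α β) :
    ∀ᶠ x in downTo α, x ∈ interval α β ∧ x < y := by
  filter_upwards [preimage_mem_comap (Ioo_mem_nhdsGT hy.1)] with x hx
  exact ⟨⟨hx.1, hx.2.trans hy.2⟩, EReal.coe_lt_coe_iff.1 hx.2⟩

lemma eventually_upTo (hy : y ∈ interval α β) :
    ∀ᶠ x in upTo β, x ∈ interval α β ∧ y < x := by
  filter_upwards [preimage_mem_comap (Ioo_mem_nhdsLT hy.2)] with x hx
  exact ⟨⟨hy.1.trans hx.1, hx.2⟩, EReal.coe_lt_coe_iff.1 hx.1⟩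

lemma downTo_neBot (hy : y ∈ interval α β) : (downTo α).NeBot := by
  refine comap_neBot fun t ht => ?_
  obtain ⟨u, hu, hut⟩ := (mem_nhdsGT_iff_exists_Ioo_subset' hy.1).1 ht
  obtain ⟨x, hx1, hx2⟩ := EReal.lt_iff_exists_real_btwn.1 hu
  exact ⟨x, hut ⟨hx1, hx2⟩⟩

lemma upTo_neBot (hy : y ∈ interval α β) : (upTo β).NeBot := by
  refine comap_neBot fun t ht => ?_
  obtain ⟨u, hu, hut⟩ := (mem_nhdsLT_iff_exists_Ioo_subset' hy.2).1 ht
  obtain ⟨x, hx1, hx2⟩ := EReal.lt_iff_exists_real_btwn.1 hu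
  exact ⟨x, hut ⟨hx1, hx2⟩⟩

end EndFilters

/-- `D` is a right-continuous version of the derivative of the convex function `F`. -/
structure IsSlope (α β : EReal) (F D : ℝ → ℝ) : Prop where
  mono : MonotoneOn D (interval α β)
  rightCont : ∀ x ∈ interval α β, Tendsto D (𝓝[>] x) (𝓝 (D x))
  integral : ∀ x ∈ interval α β, ∀ y ∈ interval α β, ∫ t in x..y, D t = F y - F x
  measure_Ioc : ∀ x ∈ interval α β, ∀ y ∈ interval α β, x ≤ y →
    secondDeriv α β F (Ioc x y) = ENNReal.ofReal (D y - D x)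

lemma monotone_rightDeriv {α β : EReal} {F : ℝ → ℝ} (hF : ConvexOn ℝ (interval α β) F) :
    Monotone fun x : interval α β => rightDeriv F x := by
  have h := hF.monotoneOn_rightDeriv
  rw [(isOpen_interval α β).interior_eq] at h
  exact fun x y hxy => h x.2 y.2 hxy

lemma secondDeriv_eq {α β : EReal} {F : ℝ → ℝ} (hF : ConvexOn ℝ (interval α β) F) :
    secondDeriv α β F =
      ((monotone_rightDeriv hF).stieltjesFunction.measure).map Subtype.val := by
  rw [secondDeriv, dif_pos (monotone_rightDeriv hF)]

lemma sigmaFinite_secondDeriv {α β : EReal} {F : ℝ → ℝ} (hF : ConvexOn ℝ (interval α β) F) :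
    SigmaFinite (secondDeriv α β F) := by
  rw [secondDeriv_eq hF]
  exact (MeasurableEmbedding.subtype_coe (measurableSet_interval α β)).sigmaFinite_map

lemma secondDeriv_compl_interval (α β : EReal) (F : ℝ → ℝ) :
    secondDeriv α β F (interval α β)ᶜ = 0 := by
  rw [secondDeriv]
  split_ifs with h
  · rw [(MeasurableEmbedding.subtype_coe (measurableSet_interval α β)).map_apply]
    have : (Subtype.val : interval α β → ℝ) ⁻¹' (interval α β)ᶜ = ∅ := by
      ext x
      simp
    rw [this, measure_empty]
  · simp

theorem exists_isSlope {α β : EReal} {F : ℝ → ℝ} (hF : ConvexOn ℝ (interval α β) F) :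
    ∃ D, IsSlope α β F D := by
  classical
  set s := (monotone_rightDeriv hF).stieltjesFunction with hs
  have hint := (isOpen_interval α β).interior_eq
  obtain ⟨D, hD⟩ : ∃ D : ℝ → ℝ, ∀ x (hx : x ∈ interval α β), D x = s ⟨x, hx⟩ :=
    ⟨fun x => if h : x ∈ interval α β then s ⟨x, h⟩ else 0, fun x hx => dif_pos hx⟩
  refine ⟨D, ?_, ?_, ?_, ?_⟩
  · intro x hx y hy hxy
    rw [hD x hx, hD y hy]
    exact s.mono hxy
  · intro x hx
    rw [hD x hx]
    have h1 : Tendsto s (𝓝[Ici (⟨x, hx⟩ : interval α β)] ⟨x, hx⟩) (𝓝 (s ⟨x, hx⟩)) :=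
      s.right_continuous ⟨x, hx⟩
    have h2 := Topology.IsInducing.subtypeVal.map_nhdsWithin_eq
      (Ici (⟨x, hx⟩ : interval α β)) ⟨x, hx⟩
    have h3 : 𝓝[Subtype.val '' Ici (⟨x, hx⟩ : interval α β)] x = 𝓝[≥] x := by
      have : Subtype.val '' Ici (⟨x, hx⟩ : interval α β) = Ici x ∩ interval α β := by
        ext t
        constructor
        · rintro ⟨u, hu, rfl⟩
          exact ⟨hu, u.2⟩
        · rintro ⟨ht, htI⟩
          exact ⟨⟨t, htI⟩, ht, rfl⟩
      rw [this, nhdsWithin_inter_of_mem']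
      exact mem_nhdsWithin_of_mem_nhds ((isOpen_interval α β).mem_nhds hx)
    refine Tendsto.mono_left ?_ (nhdsWithin_mono x Ioi_subset_Ici_self)
    rw [← h3, ← h2, tendsto_map'_iff]
    refine h1.congr fun u => ?_
    exact (hD u u.2).symm
  · intro x hx y hy
    have hsub := uIcc_subset_interval hx hy
    have h1 : ∫ t in x..y, rightDeriv F t = F y - F x := by
      refine intervalIntegral.integral_eq_sub_of_hasDeriv_right ?_ ?_ ?_
      · have := hF.continuousOn_interior
        rw [hint] at this
        exact this.mono hsub
      · intro t ht
        refine hF.hasDerivWithinAt_rightDeriv_of_mem_interior ?_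
        rw [hint]
        exact hsub ⟨ht.1.le, ht.2.le⟩
      · refine MonotoneOn.intervalIntegrable fun t ht u hu htu => ?_
        exact monotone_rightDeriv hF (show (⟨t, hsub ht⟩ : interval α β) ≤ ⟨u, hsub hu⟩ from htu)
    rw [← h1]
    refine intervalIntegral.integral_congr_ae ?_
    have hc := ((monotone_rightDeriv hF).countable_not_continuousAt).image Subtype.val
    filter_upwards [hc.ae_notMem volume] with t ht htI
    have htI := hsub (uIoc_subset_uIcc htI)
    rw [hD t htI]
    by_contra hne
    refine ht ⟨⟨t, htI⟩, fun hcont => hne ?_, rfl⟩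
    exact hcont.continuousWithinAt.rightLim_eq
  · intro x hx y hy hxy
    rw [hD x hx, hD y hy, secondDeriv_eq hF,
      (MeasurableEmbedding.subtype_coe (measurableSet_interval α β)).map_apply,
      ← StieltjesFunction.measure_Ioc]
    congr 1

namespace IsSlope

variable {α β : EReal} {F D : ℝ → ℝ}

lemma intervalIntegrable (h : IsSlope α β F D) {x y : ℝ} (hx : x ∈ interval α β)
    (hy : y ∈ interval α β) : IntervalIntegrable D volume x y :=
  MonotoneOn.intervalIntegrable (h.mono.mono (uIcc_subset_interval hx hy))

lemma stronglyMeasurableAtFilter (h : IsSlope α β F D) {x : ℝ} (hx : x ∈ interval α β) :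
    StronglyMeasurableAtFilter D (𝓝 x) volume := by
  obtain ⟨l, u, hlu, hsub⟩ :=
    mem_nhds_iff_exists_Ioo_subset.1 ((isOpen_interval α β).mem_nhds hx)
  obtain ⟨l', hl'⟩ := exists_between hlu.1
  obtain ⟨u', hu'⟩ := exists_between hlu.2
  have hl'I : l' ∈ interval α β := hsub ⟨hl'.1, hl'.2.trans hlu.2⟩
  have hu'I : u' ∈ interval α β := hsub ⟨hlu.1.trans hu'.1, hu'.2⟩
  exact ⟨Ioc l' u', Ioc_mem_nhds hl'.2 hu'.1,
      ((intervalIntegrable_iff_integrableOn_Ioc_of_le (hl'.2.trans hu'.1).le).1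
        (h.intervalIntegrable hl'I hu'I)).aestronglyMeasurable⟩

lemma ae_hasDerivAt (h : IsSlope α β F D) :
    ∀ᵐ x : ℝ, x ∈ interval α β → HasDerivAt F (D x) x := by
  filter_upwards [h.mono.countable_not_continuousWithinAt.ae_notMem volume] with x hx hxI
  have hnhds := (isOpen_interval α β).mem_nhds hxI
  have hcont : ContinuousAt D x := by
    by_contra hne
    exact hx ⟨hxI, fun hc => hne (hc.continuousAt hnhds)⟩
  have hd := intervalIntegral.integral_hasDerivAt_right
    (h.intervalIntegrable hxI hxI) (h.stronglyMeasurableAtFilter hxI) hcont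
  refine (hd.add_const (F x)).congr_of_eventuallyEq ?_
  filter_upwards [hnhds] with t ht
  rw [h.integral x hxI t ht]
  ring

lemma exists_leftLim (h : IsSlope α β F D) {x : ℝ} (hx : x ∈ interval α β) :
    ∃ c, Tendsto D (𝓝[<] x) (𝓝 c) := by
  obtain ⟨l, u, hlu, hsub⟩ :=
    mem_nhds_iff_exists_Ioo_subset.1 ((isOpen_interval α β).mem_nhds hx)
  have hne : (Ioo l x).Nonempty := nonempty_Ioo.2 hlu.1
  have hs : Ioo l x ⊆ interval α β := fun t ht => hsub ⟨ht.1, ht.2.trans hlu.2⟩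
  exact ⟨_, (h.mono.mono hs).tendsto_nhdsWithin_Ioo_left hne
    ⟨D x, by
      rintro _ ⟨t, ht, rfl⟩
      exact h.mono (hs ht) hx ht.2.le⟩⟩

end IsSlope

namespace IsSlope

variable {α β : EReal} {F D : ℝ → ℝ} {x c : ℝ}

lemma hasDerivWithinAt_Iic (h : IsSlope α β F D) (hx : x ∈ interval α β)
    (hc : Tendsto D (𝓝[<] x) (𝓝 c)) : HasDerivWithinAt F c (Iic x) x := by
  have hle : 𝓝[≤] x ⊓ ae volume ≤ 𝓝[<] x := by
    rw [show Iio x = Iic x ∩ {x}ᶜ by ext t; simp [lt_iff_le_and_ne], nhdsWithin_inter']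
    refine le_inf inf_le_left (inf_le_right.trans ?_)
    rw [le_principal_iff]
    exact compl_mem_ae_iff.2 (measure_singleton x)
  have hd := intervalIntegral.integral_hasDerivWithinAt_of_tendsto_ae_right (a := x) (b := x)
    (s := Iic x) (t := Iic x) (h.intervalIntegrable hx hx)
    ((h.stronglyMeasurableAtFilter hx).filter_mono nhdsWithin_le_nhds) (hc.mono_left hle)
  refine (hd.add_const (F x)).congr_of_eventuallyEq ?_ (by simp)
  filter_upwards [mem_nhdsWithin_of_mem_nhds ((isOpen_interval α β).mem_nhds hx)] with t ht
  rw [h.integral x hx t ht]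
  ring

lemma hasDerivWithinAt_Ici (h : IsSlope α β F D) (hx : x ∈ interval α β) :
    HasDerivWithinAt F (D x) (Ici x) x := by
  have hd := intervalIntegral.integral_hasDerivWithinAt_of_tendsto_ae_right (a := x) (b := x)
    (s := Ici x) (t := Ioi x) (h.intervalIntegrable hx hx)
    ((h.stronglyMeasurableAtFilter hx).filter_mono nhdsWithin_le_nhds)
    ((h.rightCont x hx).mono_left inf_le_left)
  refine (hd.add_const (F x)).congr_of_eventuallyEq ?_ (by simp)
  filter_upwards [mem_nhdsWithin_of_mem_nhds ((isOpen_interval α β).mem_nhds hx)] with t ht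
  rw [h.integral x hx t ht]
  ring

end IsSlope

/-- Where a difference of convex functions is differentiable, its right-continuous derivative
is continuous. -/
lemma slope_sub_of_hasDerivAt {α β : EReal} {g g₁ g₂ D₁ D₂ : ℝ → ℝ} {x m : ℝ}
    (h₁ : IsSlope α β g₁ D₁) (h₂ : IsSlope α β g₂ D₂)
    (hg : ∀ x ∈ interval α β, g x = g₁ x - g₂ x) (hx : x ∈ interval α β)
    (hm : HasDerivAt g m x) :
    D₁ x - D₂ x = m ∧ Tendsto (fun t => D₁ t - D₂ t) (𝓝[<] x) (𝓝 m) := by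
  have hnhds := (isOpen_interval α β).mem_nhds hx
  have hm' : HasDerivAt (fun t => g₁ t - g₂ t) m x :=
    hm.congr_of_eventuallyEq (by filter_upwards [hnhds] with t ht using (hg t ht).symm)
  constructor
  · exact (uniqueDiffWithinAt_Ici x).eq_deriv _
      ((h₁.hasDerivWithinAt_Ici hx).sub (h₂.hasDerivWithinAt_Ici hx)) hm'.hasDerivWithinAt
  · obtain ⟨c₁, hc₁⟩ := h₁.exists_leftLim hx
    obtain ⟨c₂, hc₂⟩ := h₂.exists_leftLim hx
    have : c₁ - c₂ = m := (uniqueDiffWithinAt_Iic x).eq_deriv _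
      ((h₁.hasDerivWithinAt_Iic hx hc₁).sub (h₂.hasDerivWithinAt_Iic hx hc₂))
      hm'.hasDerivWithinAt
    rw [← this]
    exact hc₁.sub hc₂

lemma _root_.MeasureTheory.IntegrableOn.mul_monotoneOn {w D : ℝ → ℝ} {y z : ℝ}
    (hw : IntegrableOn w (Ioc y z)) (hD : MonotoneOn D (Icc y z)) :
    IntegrableOn (fun t => w t * D t) (Ioc y z) := by
  rcases le_or_gt z y with hyz | hyz
  · simp [Ioc_eq_empty_of_le hyz]
  have hyI : y ∈ Icc y z := left_mem_Icc.2 hyz.le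
  have hzI : z ∈ Icc y z := right_mem_Icc.2 hyz.le
  refine Integrable.mul_bdd (c := max |D y| |D z|) hw
    (aemeasurable_restrict_of_monotoneOn measurableSet_Ioc
      (hD.mono Ioc_subset_Icc_self)).aestronglyMeasurable ?_
  filter_upwards [ae_restrict_mem measurableSet_Ioc] with t ht
  have ht' := Ioc_subset_Icc_self ht
  exact abs_le_max_abs_abs (hD hyI ht' ht'.1) (hD ht' hzI ht'.2)

/-- Integration by parts of an absolutely continuous function against a measure with
cumulative distribution function `D`. -/
theorem setIntegral_Ioc_eq_sub_integral_deriv_mul {ν : Measure ℝ} {D k : ℝ → ℝ} {y z : ℝ}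
    (hyz : y ≤ z) (hD : MonotoneOn D (Icc y z))
    (hν : ∀ t ∈ Icc y z, ν (Ioc y t) = ENNReal.ofReal (D t - D y))
    (hk : AbsolutelyContinuousOnInterval k y z) :
    ∫ s in Ioc y z, k s ∂ν = k z * D z - k y * D y - ∫ t in y..z, deriv k t * D t := by
  have hyI : y ∈ Icc y z := left_mem_Icc.2 hyz
  have hzI : z ∈ Icc y z := right_mem_Icc.2 hyz
  have hfin : IsFiniteMeasure (ν.restrict (Ioc y z)) := by
    refine ⟨?_⟩
    rw [Measure.restrict_apply_univ, hν z hzI]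
    exact ENNReal.ofReal_lt_top
  have hkint := hk.intervalIntegrable_deriv
  have hk' : IntegrableOn (deriv k) (Ioc y z) :=
    (intervalIntegrable_iff_integrableOn_Ioc_of_le hyz).1 hkint
  have hDint : IntervalIntegrable D volume y z :=
    MonotoneOn.intervalIntegrable (by rwa [uIcc_of_le hyz])
  have hkcont : ContinuousOn k (Icc y z) := by
    have := hk.continuousOn
    rwa [uIcc_of_le hyz] at this
  have hkν : IntegrableOn k (Ioc y z) ν := by
    obtain ⟨C, hC⟩ := isCompact_Icc.exists_bound_of_continuousOn hkcont
    refine Integrable.of_bound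
      ((hkcont.mono Ioc_subset_Icc_self).aestronglyMeasurable measurableSet_Ioc) C ?_
    filter_upwards [ae_restrict_mem measurableSet_Ioc] with s hs
    exact hC s (Ioc_subset_Icc_self hs)
  have hreal : ∀ t ∈ Icc y z, (ν.restrict (Ioc y z)).real (Iic t) = D t - D y := by
    intro t ht
    rw [measureReal_restrict_apply measurableSet_Iic, inter_comm, Ioc_inter_Iic,
      min_eq_right ht.2, measureReal_def, hν t ht,
      ENNReal.toReal_ofReal (sub_nonneg.2 (hD hyI ht ht.1))]
  have hE : MeasurableSet {p : ℝ × ℝ | p.1 ≤ p.2} :=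
    measurableSet_le measurable_fst measurable_snd
  have hint : Integrable (Function.uncurry fun s t : ℝ =>
      {p : ℝ × ℝ | p.1 ≤ p.2}.indicator (fun p => deriv k p.2) (s, t))
      ((ν.restrict (Ioc y z)).prod (volume.restrict (Ioc y z))) :=
    (hk'.comp_snd (ν.restrict (Ioc y z))).indicator hE
  have hswap := integral_integral_swap hint
  have hleft : ∫ s in Ioc y z, ∫ t in Ioc y z,
      {p : ℝ × ℝ | p.1 ≤ p.2}.indicator (fun p => deriv k p.2) (s, t) ∂volume ∂ν
      = k z * (D z - D y) - ∫ s in Ioc y z, k s ∂ν := by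
    have h1 : ∀ s ∈ Ioc y z, ∫ t in Ioc y z,
        {p : ℝ × ℝ | p.1 ≤ p.2}.indicator (fun p => deriv k p.2) (s, t) = k z - k s := by
      intro s hs
      have h2 : (fun t => {p : ℝ × ℝ | p.1 ≤ p.2}.indicator (fun p => deriv k p.2) (s, t))
          = (Ici s).indicator (deriv k) := by
        ext t
        simp [indicator]
      rw [h2, setIntegral_indicator measurableSet_Ici]
      have h3 : Ioc y z ∩ Ici s = Icc s z := by
        ext t
        exact ⟨fun h => ⟨h.2, h.1.2⟩, fun h => ⟨⟨hs.1.trans_le h.1, h.2⟩, h.1⟩⟩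
      rw [h3, integral_Icc_eq_integral_Ioc, ← intervalIntegral.integral_of_le hs.2]
      exact (hk.mono (uIcc_subset_uIcc_right (by
        rw [uIcc_of_le hyz]
        exact Ioc_subset_Icc_self hs))).integral_deriv_eq_sub
    rw [setIntegral_congr_fun measurableSet_Ioc h1, integral_sub (integrable_const _) hkν,
      integral_const, smul_eq_mul, mul_comm, ← hreal z hzI]
    congr 2
    rw [measureReal_restrict_apply MeasurableSet.univ, univ_inter,
      measureReal_restrict_apply measurableSet_Iic, inter_comm, Ioc_inter_Iic, min_self]
  have hright : ∫ t in Ioc y z, ∫ s in Ioc y z,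
      {p : ℝ × ℝ | p.1 ≤ p.2}.indicator (fun p => deriv k p.2) (s, t) ∂ν
      = (∫ t in y..z, deriv k t * D t) - (k z - k y) * D y := by
    have h1 : ∀ t ∈ Ioc y z, ∫ s in Ioc y z,
        {p : ℝ × ℝ | p.1 ≤ p.2}.indicator (fun p => deriv k p.2) (s, t) ∂ν
        = deriv k t * D t - deriv k t * D y := by
      intro t ht
      have h2 : (fun s => {p : ℝ × ℝ | p.1 ≤ p.2}.indicator (fun p => deriv k p.2) (s, t))
          = (Iic t).indicator fun _ => deriv k t := by
        ext s
        simp [indicator]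
      rw [h2, integral_indicator_const _ measurableSet_Iic, smul_eq_mul,
        hreal t (Ioc_subset_Icc_self ht)]
      ring
    rw [setIntegral_congr_fun measurableSet_Ioc h1, ← intervalIntegral.integral_of_le hyz,
      intervalIntegral.integral_sub, intervalIntegral.integral_mul_const,
      hk.integral_deriv_eq_sub]
    · exact (intervalIntegrable_iff_integrableOn_Ioc_of_le hyz).2 (hk'.mul_monotoneOn hD)
    · exact hkint.mul_const _
  rw [hleft, hright] at hswap
  linarith

/-- The reciprocal of a positive absolutely continuous function is absolutely continuous. -/
theorem _root_.AbsolutelyContinuousOnInterval.inv_of_pos {u : ℝ → ℝ} {a b : ℝ}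
    (hu : AbsolutelyContinuousOnInterval u a b) (hpos : ∀ x ∈ uIcc a b, 0 < u x) :
    AbsolutelyContinuousOnInterval (fun x => (u x)⁻¹) a b := by
  obtain ⟨x₀, hx₀, hmin⟩ := isCompact_uIcc.exists_isMinOn nonempty_uIcc hu.continuousOn
  have hc := hpos x₀ hx₀
  set c := u x₀
  rw [absolutelyContinuousOnInterval_iff] at hu ⊢
  intro ε hε
  obtain ⟨δ, hδ, h⟩ := hu (c ^ 2 * ε) (by positivity)
  refine ⟨δ, hδ, fun E hE₁ hE₂ => ?_⟩
  have h' := h E hE₁ hE₂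
  have hle : ∑ i ∈ Finset.range E.1, dist ((u (E.2 i).1)⁻¹) ((u (E.2 i).2)⁻¹) ≤
      ∑ i ∈ Finset.range E.1, (c ^ 2)⁻¹ * dist (u (E.2 i).1) (u (E.2 i).2) := by
    refine Finset.sum_le_sum fun i hi => ?_
    have hm := hE₁.1 i hi
    have h1 := hpos _ hm.1
    have h2 := hpos _ hm.2
    have hc1 : c ≤ u (E.2 i).1 := hmin hm.1
    have hc2 : c ≤ u (E.2 i).2 := hmin hm.2
    rw [Real.dist_eq, Real.dist_eq, inv_sub_inv h1.ne' h2.ne', abs_div, abs_sub_comm,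
      abs_of_pos (mul_pos h1 h2), div_eq_inv_mul]
    refine mul_le_mul_of_nonneg_right (inv_anti₀ (by positivity) ?_) (abs_nonneg _)
    rw [sq]
    exact mul_le_mul hc1 hc2 hc.le h1.le
  refine hle.trans_lt ?_
  rw [← Finset.mul_sum, inv_mul_lt_iff₀ (by positivity)]
  exact h'

lemma measurable_leftDeriv (F : ℝ → ℝ) : Measurable (leftDeriv F) := by
  have h : leftDeriv F = fun x => -derivWithin (fun t => F (-t)) (Ioi (-x)) (-x) := by
    ext x
    rw [derivWithin_comp_neg, neg_neg, neg_neg, Set.neg_Ioi, neg_neg, leftDeriv]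
  rw [h]
  exact ((measurable_derivWithin_Ioi _).comp measurable_neg).neg

section SignedDensity

variable {X : Type*} [MeasurableSpace X] {μ : Measure X} {d h : X → ℝ} {S : Set X}

lemma integrableOn_withDensity_ofReal (hd : AEMeasurable d μ) (hS : MeasurableSet S)
    (hint : IntegrableOn (fun x => d x * h x) S μ) :
    IntegrableOn h S (μ.withDensity fun x => ENNReal.ofReal (d x)) := by
  rw [IntegrableOn, restrict_withDensity hS,
    integrable_withDensity_iff_integrable_smul₀' hd.restrict.ennreal_ofReal
      (Eventually.of_forall fun _ => ENNReal.ofReal_lt_top)]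
  refine (hint.indicator₀ (hd.restrict.nullMeasurableSet_preimage
    (measurableSet_Ici (a := (0 : ℝ))))).congr (Eventually.of_forall fun x => ?_)
  by_cases hx : 0 ≤ d x
  · simp [indicator, hx, ENNReal.toReal_ofReal hx]
  · simp [indicator, hx, ENNReal.ofReal_of_nonpos (not_le.1 hx).le]

lemma setIntegral_sub_withDensity_ofReal (hd : AEMeasurable d μ) (hS : MeasurableSet S)
    (hint : IntegrableOn (fun x => d x * h x) S μ) :
    ∫ x in S, h x ∂(μ.withDensity fun x => ENNReal.ofReal (d x)) -
      ∫ x in S, h x ∂(μ.withDensity fun x => ENNReal.ofReal (-d x)) = ∫ x in S, d x * h x ∂μ := by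
  have hint' : IntegrableOn (fun x => -d x * h x) S μ := by
    exact hint.neg.congr (Eventually.of_forall fun x => (neg_mul _ _).symm)
  have hfin : ∀ e : X → ℝ, ∀ᵐ x ∂μ.restrict S, ENNReal.ofReal (e x) < ∞ :=
    fun e => Eventually.of_forall fun _ => ENNReal.ofReal_lt_top
  have aux : ∀ e : X → ℝ, AEMeasurable e μ → IntegrableOn (fun x => e x * h x) S μ →
      IntegrableOn (fun x => (ENNReal.ofReal (e x)).toReal • h x) S μ := by
    intro e he hie
    have := integrableOn_withDensity_ofReal he hS hie
    rwa [IntegrableOn, restrict_withDensity hS,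
      integrable_withDensity_iff_integrable_smul₀' he.restrict.ennreal_ofReal (hfin e)] at this
  rw [setIntegral_withDensity_eq_setIntegral_toReal_smul₀ hd.restrict.ennreal_ofReal
      (hfin _) _ hS,
    setIntegral_withDensity_eq_setIntegral_toReal_smul₀
      (f := fun x => ENNReal.ofReal (-d x)) hd.neg.restrict.ennreal_ofReal (hfin _) _ hS, ← integral_sub (aux d hd hint) (aux (fun x => -d x) hd.neg hint')]
  refine integral_congr_ae (Eventually.of_forall fun x => ?_)
  rcases le_total 0 (d x) with hx | hx
  · simp [ENNReal.toReal_ofReal hx, ENNReal.ofReal_of_nonpos (neg_nonpos.2 hx)]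
  · simp [ENNReal.toReal_ofReal (neg_nonneg.2 hx), ENNReal.ofReal_of_nonpos hx]

end SignedDensity

lemma integrableOn_rnDeriv_mul {X : Type*} [MeasurableSpace X] {ν μ : Measure X} [SigmaFinite ν]
    [SigmaFinite μ] (hνμ : ν ≪ μ) {S : Set X} (hS : MeasurableSet S) {u : X → ℝ}
    (hu : IntegrableOn u S ν) : IntegrableOn (fun x => (ν.rnDeriv μ x).toReal * u x) S μ := by
  have h := (integrable_toReal_rnDeriv_mul_iff hνμ).2 ((integrable_indicator_iff hS).2 hu)
  refine (integrable_indicator_iff hS).1 (h.congr (Eventually.of_forall fun x => ?_))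
  by_cases hx : x ∈ S <;> simp [hx]

section Lop

variable {α β : EReal} {b σ r g₁ g₂ : ℝ → ℝ}

lemma sigmaFinite_refMeasure (h₁ : ConvexOn ℝ (interval α β) g₁)
    (h₂ : ConvexOn ℝ (interval α β) g₂) : SigmaFinite (refMeasure α β g₁ g₂) := by
  have := sigmaFinite_secondDeriv h₁
  have := sigmaFinite_secondDeriv h₂
  rw [refMeasure]
  infer_instance

lemma refMeasure_restrict_interval (α β : EReal) (g₁ g₂ : ℝ → ℝ) :
    (refMeasure α β g₁ g₂).restrict (interval α β) = refMeasure α β g₁ g₂ := by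
  refine Measure.restrict_eq_self_of_ae_mem ?_
  rw [ae_iff]
  change refMeasure α β g₁ g₂ (interval α β)ᶜ = 0
  simp [refMeasure, secondDeriv_compl_interval,
    Measure.restrict_apply (measurableSet_interval α β).compl]

lemma secondDeriv_left_absolutelyContinuous (α β : EReal) (g₁ g₂ : ℝ → ℝ) :
    secondDeriv α β g₁ ≪ refMeasure α β g₁ g₂ :=
  ((Measure.le_add_right le_rfl).trans (Measure.le_add_right le_rfl)).absolutelyContinuous

lemma secondDeriv_right_absolutelyContinuous (α β : EReal) (g₁ g₂ : ℝ → ℝ) :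
    secondDeriv α β g₂ ≪ refMeasure α β g₁ g₂ :=
  ((Measure.le_add_left le_rfl).trans (Measure.le_add_right le_rfl)).absolutelyContinuous

lemma volume_absolutelyContinuous_refMeasure (α β : EReal) (g₁ g₂ : ℝ → ℝ) :
    volume.restrict (interval α β) ≪ refMeasure α β g₁ g₂ :=
  (Measure.le_add_left le_rfl).absolutelyContinuous

lemma _root_.ConvexOn.continuousOn_interval {F : ℝ → ℝ} (hF : ConvexOn ℝ (interval α β) F) :
    ContinuousOn F (interval α β) := by
  have := hF.continuousOn_interior
  rwa [(isOpen_interval α β).interior_eq] at this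

lemma aemeasurable_lopDensity (hb : Measurable fun x : interval α β => b x)
    (hσ : Measurable fun x : interval α β => σ x) (hr : Measurable fun x : interval α β => r x)
    (h₁ : ConvexOn ℝ (interval α β) g₁) (h₂ : ConvexOn ℝ (interval α β) g₂) :
    AEMeasurable (lopDensity α β b σ r g₁ g₂) (refMeasure α β g₁ g₂) := by
  have hI := measurableSet_interval α β
  rw [← refMeasure_restrict_interval]
  have hb' := aemeasurable_restrict_of_measurable_subtype (μ := refMeasure α β g₁ g₂) hI hb
  have hσ' := aemeasurable_restrict_of_measurable_subtype (μ := refMeasure α β g₁ g₂) hI hσ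
  have hr' := aemeasurable_restrict_of_measurable_subtype (μ := refMeasure α β g₁ g₂) hI hr
  have hg₁ := h₁.continuousOn_interval.aemeasurable (μ := refMeasure α β g₁ g₂) hI
  have hg₂ := h₂.continuousOn_interval.aemeasurable (μ := refMeasure α β g₁ g₂) hI
  have hρ : ∀ ν : Measure ℝ, AEMeasurable
      (fun x => (ν.rnDeriv (refMeasure α β g₁ g₂) x).toReal)
      ((refMeasure α β g₁ g₂).restrict (interval α β)) :=
    fun ν => (Measure.measurable_rnDeriv ν _).ennreal_toReal.aemeasurable
  exact (((hσ'.pow_const 2).const_mul _).mul ((hρ _).sub (hρ _))).add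
    (((hb'.mul (measurable_leftDeriv _).aemeasurable).sub (hr'.mul (hg₁.sub hg₂))).mul (hρ _))

variable {S : Set ℝ} {h : ℝ → ℝ}

theorem lopIntegral_eq (hb : Measurable fun x : interval α β => b x)
    (hσ : Measurable fun x : interval α β => σ x) (hr : Measurable fun x : interval α β => r x)
    (h₁ : ConvexOn ℝ (interval α β) g₁) (h₂ : ConvexOn ℝ (interval α β) g₂)
    (hS : MeasurableSet S) (hSI : S ⊆ interval α β)
    (hi₁ : IntegrableOn (fun x => 1 / 2 * σ x ^ 2 * h x) S (secondDeriv α β g₁))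
    (hi₂ : IntegrableOn (fun x => 1 / 2 * σ x ^ 2 * h x) S (secondDeriv α β g₂))
    (hi : IntegrableOn (fun x => (b x * leftDeriv (fun y => g₁ y - g₂ y) x -
      r x * (g₁ x - g₂ x)) * h x) S) :
    IntegrableOn h S (lopNeg α β b σ r g₁ g₂) ∧
    lopIntegral α β b σ r g₁ g₂ h S =
      ∫ x in S, 1 / 2 * σ x ^ 2 * h x ∂(secondDeriv α β g₁) -
      ∫ x in S, 1 / 2 * σ x ^ 2 * h x ∂(secondDeriv α β g₂) +
      ∫ x in S, (b x * leftDeriv (fun y => g₁ y - g₂ y) x - r x * (g₁ x - g₂ x)) * h x := by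
  have := sigmaFinite_secondDeriv h₁
  have := sigmaFinite_secondDeriv h₂
  have := sigmaFinite_refMeasure h₁ h₂
  have hac₁ := secondDeriv_left_absolutelyContinuous α β g₁ g₂
  have hac₂ := secondDeriv_right_absolutelyContinuous α β g₁ g₂
  have hac₀ := volume_absolutelyContinuous_refMeasure α β g₁ g₂
  have hvol : (volume.restrict (interval α β)).restrict S = volume.restrict S := by
    rw [Measure.restrict_restrict hS, inter_eq_left.2 hSI]
  have hi₀ : IntegrableOn (fun x => (b x * leftDeriv (fun y => g₁ y - g₂ y) x -
      r x * (g₁ x - g₂ x)) * h x) S (volume.restrict (interval α β)) := by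
    rw [IntegrableOn, hvol]
    exact hi
  have hd := aemeasurable_lopDensity hb hσ hr h₁ h₂
  have hj₁ := integrableOn_rnDeriv_mul hac₁ hS hi₁
  have hj₂ := integrableOn_rnDeriv_mul hac₂ hS hi₂
  have hj₀ := integrableOn_rnDeriv_mul hac₀ hS hi₀
  have hsum := (hj₁.sub hj₂).add hj₀
  have heq : (fun x => lopDensity α β b σ r g₁ g₂ x * h x) = fun x =>
      ((secondDeriv α β g₁).rnDeriv (refMeasure α β g₁ g₂) x).toReal *
          (1 / 2 * σ x ^ 2 * h x) -
        ((secondDeriv α β g₂).rnDeriv (refMeasure α β g₁ g₂) x).toReal *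
          (1 / 2 * σ x ^ 2 * h x) +
        ((volume.restrict (interval α β)).rnDeriv (refMeasure α β g₁ g₂) x).toReal *
          ((b x * leftDeriv (fun y => g₁ y - g₂ y) x - r x * (g₁ x - g₂ x)) * h x) := by
    ext x
    rw [lopDensity]
    ring
  have hint : IntegrableOn (fun x => lopDensity α β b σ r g₁ g₂ x * h x) S
      (refMeasure α β g₁ g₂) := by
    rw [heq]
    exact hsum
  constructor
  · refine integrableOn_withDensity_ofReal hd.neg hS ?_
    exact hint.neg.congr (Eventually.of_forall fun x => (neg_mul _ _).symm)
  · rw [lopIntegral, lopPos, lopNeg, setIntegral_sub_withDensity_ofReal hd hS hint, heq,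
      integral_add (by exact hj₁.sub hj₂) hj₀, integral_sub hj₁ hj₂, setIntegral_toReal_rnDeriv_mul hac₁ hS,
      setIntegral_toReal_rnDeriv_mul hac₂ hS, setIntegral_toReal_rnDeriv_mul hac₀ hS, hvol]

end Lop

section ODE

variable {α β : EReal} {b σ r f φ ψ : ℝ → ℝ} {x y z : ℝ}

lemma SolvesODE.hasDerivAt (h : SolvesODE α β b σ r f) (hx : x ∈ interval α β) :
    HasDerivAt f (deriv f x) x :=
  ((h.contDiffOn.differentiableOn (by simp)).differentiableAt
    ((isOpen_interval α β).mem_nhds hx)).hasDerivAt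

lemma SolvesODE.continuousOn (h : SolvesODE α β b σ r f) : ContinuousOn f (interval α β) :=
  h.contDiffOn.continuousOn

lemma SolvesODE.continuousOn_deriv (h : SolvesODE α β b σ r f) :
    ContinuousOn (deriv f) (interval α β) :=
  h.contDiffOn.continuousOn_deriv_of_isOpen (isOpen_interval α β) le_rfl

lemma SolvesODE.absolutelyContinuous (h : SolvesODE α β b σ r f) (hy : y ∈ interval α β)
    (hz : z ∈ interval α β) : AbsolutelyContinuousOnInterval f y z :=
  (h.contDiffOn.mono (uIcc_subset_interval hy hz)).absolutelyContinuousOnInterval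

lemma wronskian_pos (h : FundamentalSolutions α β b σ r φ ψ) (hx : x ∈ interval α β) :
    0 < wronskian φ ψ x := by
  have h1 := mul_pos (h.φ_pos x hx) (h.ψ_deriv_pos x hx)
  have h2 := mul_pos (neg_pos.2 (h.φ_deriv_neg x hx)) (h.ψ_pos x hx)
  rw [wronskian]
  linarith

lemma continuousOn_wronskian (h : FundamentalSolutions α β b σ r φ ψ) :
    ContinuousOn (wronskian φ ψ) (interval α β) :=
  (h.solves_φ.continuousOn.mul h.solves_ψ.continuousOn_deriv).sub
    (h.solves_φ.continuousOn_deriv.mul h.solves_ψ.continuousOn)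

lemma absolutelyContinuous_wronskian (h : FundamentalSolutions α β b σ r φ ψ)
    (hy : y ∈ interval α β) (hz : z ∈ interval α β) (hyz : y < z) :
    AbsolutelyContinuousOnInterval (wronskian φ ψ) y z :=
  ((h.solves_φ.absolutelyContinuous hy hz).mul (h.solves_ψ.absCont y hy z hz hyz)).sub
    ((h.solves_φ.absCont y hy z hz hyz).mul (h.solves_ψ.absolutelyContinuous hy hz))

lemma ae_hasDerivAt_wronskian (hσ : ∀ x ∈ interval α β, 0 < σ x ^ 2)
    (h : FundamentalSolutions α β b σ r φ ψ)
    (hy : y ∈ interval α β) (hz : z ∈ interval α β) (hyz : y < z) :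
    ∀ᵐ t, t ∈ uIcc y z →
      HasDerivAt (wronskian φ ψ) (-(2 * b t / σ t ^ 2) * wronskian φ ψ t) t := by
  filter_upwards [(h.solves_φ.absCont y hy z hz hyz).ae_differentiableAt,
    (h.solves_ψ.absCont y hy z hz hyz).ae_differentiableAt, h.solves_φ.ode, h.solves_ψ.ode]
    with t h1 h2 h3 h4 ht
  have htI := uIcc_subset_interval hy hz ht
  have hd := ((h.solves_φ.hasDerivAt htI).mul (h2 ht).hasDerivAt).sub
    ((h1 ht).hasDerivAt.mul (h.solves_ψ.hasDerivAt htI))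
  refine hd.congr_deriv ?_
  have hs : σ t ≠ 0 := ne_zero_pow two_ne_zero (hσ t htI).ne'
  have e1 := h3 htI
  have e2 := h4 htI
  rw [wronskian]
  field_simp
  linear_combination 2 * φ t * e2 - 2 * ψ t * e1

lemma ae_hasDerivAt_div_wronskian (hσ : ∀ x ∈ interval α β, 0 < σ x ^ 2)
    (h : FundamentalSolutions α β b σ r φ ψ) (hf : SolvesODE α β b σ r f)
    (hy : y ∈ interval α β) (hz : z ∈ interval α β) (hyz : y < z) :
    ∀ᵐ t, t ∈ uIcc y z →
      HasDerivAt (fun x => f x * (wronskian φ ψ x)⁻¹)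
        (deriv f t * (wronskian φ ψ t)⁻¹ +
          2 * b t / σ t ^ 2 * (f t * (wronskian φ ψ t)⁻¹)) t ∧
      HasDerivAt (fun x => deriv f x * (wronskian φ ψ x)⁻¹)
        (2 * r t / σ t ^ 2 * (f t * (wronskian φ ψ t)⁻¹)) t := by
  filter_upwards [(hf.absCont y hy z hz hyz).ae_differentiableAt, hf.ode,
    ae_hasDerivAt_wronskian hσ h hy hz hyz] with t h1 h2 h3 ht
  have htI := uIcc_subset_interval hy hz ht
  have hs : σ t ≠ 0 := ne_zero_pow two_ne_zero (hσ t htI).ne'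
  have hW := (wronskian_pos h htI).ne'
  have hWi := (h3 ht).inv hW
  constructor
  · refine ((hf.hasDerivAt htI).mul hWi).congr_deriv ?_
    rw [Pi.inv_apply]
    field_simp
  · refine ((h1 ht).hasDerivAt.mul hWi).congr_deriv ?_
    rw [Pi.inv_apply]
    have e := h2 htI
    field_simp
    linear_combination 2 * e

end ODE

lemma IsSlope.integral_deriv_mul_add {α β : EReal} {F D m : ℝ → ℝ} (h : IsSlope α β F D)
    {y z : ℝ} (hy : y ∈ interval α β) (hz : z ∈ interval α β)
    (hm : AbsolutelyContinuousOnInterval m y z) :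
    ∫ t in y..z, (deriv m t * F t + m t * D t) = m z * F z - m y * F y := by
  have hDi := h.intervalIntegrable hy hz
  have hG : ∀ t ∈ uIcc y z, F y + ∫ s in y..t, D s = F t := fun t ht => by
    rw [h.integral y hy t (uIcc_subset_interval hy hz ht)]
    ring
  have hGac : AbsolutelyContinuousOnInterval (fun t => F y + ∫ s in y..t, D s) y z :=
    ((contDiff_const (c := F y)).contDiffOn.absolutelyContinuousOnInterval).add
      (hDi.absolutelyContinuousOnInterval_intervalIntegral left_mem_uIcc)
  have := hm.integral_deriv_mul_eq_sub hGac
  rw [hG y left_mem_uIcc, hG z right_mem_uIcc] at this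
  rw [← this]
  refine intervalIntegral.integral_congr_ae ?_
  filter_upwards [hDi.ae_hasDerivAt_integral] with t ht htI
  have htI' := uIoc_subset_uIcc htI
  rw [hG t htI', ((ht htI' y left_mem_uIcc).const_add (F y)).deriv]

/-- The coefficient `(f g' - f' g) / 𝒲` of `g` with respect to the fundamental solutions, where
`D` stands for `g'`. -/
noncomputable def coef (φ ψ f g D : ℝ → ℝ) (x : ℝ) : ℝ := (f x * D x - deriv f x * g x) / wronskian φ ψ x

/-- Lagrange's identity: the integral of `2 f / (σ² 𝒲)` against `ℒg` is the increment of
`(f g' - f' g) / 𝒲`. -/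
theorem lopIntegral_weight_Ioc {α β : EReal} {b σ r f φ ψ g₁ g₂ D₁ D₂ : ℝ → ℝ}
    (hdiff : DiffusionCoefficients α β b σ) (hdisc : DiscountRate α β σ r)
    (hfund : FundamentalSolutions α β b σ r φ ψ) (hf : SolvesODE α β b σ r f)
    (h₁ : ConvexOn ℝ (interval α β) g₁) (h₂ : ConvexOn ℝ (interval α β) g₂)
    (hD₁ : IsSlope α β g₁ D₁) (hD₂ : IsSlope α β g₂ D₂) {y z : ℝ}
    (hy : y ∈ interval α β) (hz : z ∈ interval α β) (hyz : y < z) :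
    IntegrableOn (fun s => 2 * weight σ φ ψ f s) (Ioc y z) (lopNeg α β b σ r g₁ g₂) ∧
    lopIntegral α β b σ r g₁ g₂ (fun s => 2 * weight σ φ ψ f s) (Ioc y z) =
      coef φ ψ f (fun t => g₁ t - g₂ t) (fun t => D₁ t - D₂ t) z -
      coef φ ψ f (fun t => g₁ t - g₂ t) (fun t => D₁ t - D₂ t) y := by
  have hIcc := Icc_subset_interval hy hz
  have huIcc := uIcc_subset_interval hy hz
  have hIoc : Ioc y z ⊆ interval α β := Ioc_subset_Icc_self.trans hIcc
  set k : ℝ → ℝ := fun x => f x * (wronskian φ ψ x)⁻¹ with hk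
  set m : ℝ → ℝ := fun x => deriv f x * (wronskian φ ψ x)⁻¹ with hm
  have hWac := (absolutelyContinuous_wronskian hfund hy hz hyz).inv_of_pos
    fun x hx => wronskian_pos hfund (huIcc hx)
  have hkac : AbsolutelyContinuousOnInterval k y z := (hf.absolutelyContinuous hy hz).mul hWac
  have hmac : AbsolutelyContinuousOnInterval m y z := (hf.absCont y hy z hz hyz).mul hWac
  have hkcont : ContinuousOn k (Icc y z) := by
    have := hkac.continuousOn
    rwa [uIcc_of_le hyz.le] at this
  have hkh : ∀ x ∈ Ioc y z, 1 / 2 * σ x ^ 2 * (2 * weight σ φ ψ f x) = k x := by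
    intro x hx
    have hs : σ x ≠ 0 := ne_zero_pow two_ne_zero (hdiff.σ_sq_pos x (hIoc hx)).ne'
    have hW := (wronskian_pos hfund (hIoc hx)).ne'
    rw [hk, weight]
    field_simp
  have hparts : ∀ {F D : ℝ → ℝ}, ConvexOn ℝ (interval α β) F → IsSlope α β F D →
      IntegrableOn (fun x => 1 / 2 * σ x ^ 2 * (2 * weight σ φ ψ f x)) (Ioc y z)
        (secondDeriv α β F) ∧
      ∫ x in Ioc y z, 1 / 2 * σ x ^ 2 * (2 * weight σ φ ψ f x) ∂(secondDeriv α β F) =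
        k z * D z - k y * D y - ∫ t in y..z, deriv k t * D t := by
    intro F D hF hD
    constructor
    · refine IntegrableOn.congr_fun ?_ (fun x hx => (hkh x hx).symm) measurableSet_Ioc
      obtain ⟨C, hC⟩ := isCompact_Icc.exists_bound_of_continuousOn hkcont
      have : IsFiniteMeasure ((secondDeriv α β F).restrict (Ioc y z)) := by
        refine ⟨?_⟩
        rw [Measure.restrict_apply_univ, hD.measure_Ioc y hy z hz hyz.le]
        exact ENNReal.ofReal_lt_top
      refine Integrable.of_bound
        ((hkcont.mono Ioc_subset_Icc_self).aestronglyMeasurable measurableSet_Ioc) C ?_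
      filter_upwards [ae_restrict_mem measurableSet_Ioc] with s hs
      exact hC s (Ioc_subset_Icc_self hs)
    · rw [setIntegral_congr_fun measurableSet_Ioc hkh]
      exact setIntegral_Ioc_eq_sub_integral_deriv_mul hyz.le (hD.mono.mono hIcc)
        (fun t ht => hD.measure_Ioc y hy t (hIcc ht) ht.1) hkac
  have hkD : ∀ {F D : ℝ → ℝ}, IsSlope α β F D →
      IntegrableOn (fun t => deriv k t * D t) (Ioc y z) := fun hD =>
    ((intervalIntegrable_iff_integrableOn_Ioc_of_le hyz.le).1
      hkac.intervalIntegrable_deriv).mul_monotoneOn (hD.mono.mono hIcc)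
  have hmD : ∀ {F D : ℝ → ℝ}, ConvexOn ℝ (interval α β) F → IsSlope α β F D →
      IntegrableOn (fun t => deriv m t * F t + m t * D t) (Ioc y z) := fun hF hD =>
    (intervalIntegrable_iff_integrableOn_Ioc_of_le hyz.le).1
      ((hmac.intervalIntegrable_deriv.mul_continuousOn (hF.continuousOn_interval.mono huIcc)).add
        ((hD.intervalIntegrable hy hz).continuousOn_mul hmac.continuousOn))
  have hae : (fun x => (b x * leftDeriv (fun y => g₁ y - g₂ y) x - r x * (g₁ x - g₂ x)) *
      (2 * weight σ φ ψ f x)) =ᵐ[volume.restrict (Ioc y z)] fun t =>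
      (deriv k t * D₁ t - (deriv m t * g₁ t + m t * D₁ t)) -
        (deriv k t * D₂ t - (deriv m t * g₂ t + m t * D₂ t)) := by
    rw [EventuallyEq, ae_restrict_iff' measurableSet_Ioc]
    filter_upwards [ae_hasDerivAt_div_wronskian hdiff.σ_sq_pos hfund hf hy hz hyz,
      hD₁.ae_hasDerivAt, hD₂.ae_hasDerivAt] with t h h1 h2 ht
    have htI := hIoc ht
    obtain ⟨hkt, hmt⟩ := h (by rw [uIcc_of_le hyz.le]; exact Ioc_subset_Icc_self ht)
    have hl : leftDeriv (fun y => g₁ y - g₂ y) t = D₁ t - D₂ t :=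
      ((h1 htI).sub (h2 htI)).hasDerivWithinAt.derivWithin (uniqueDiffWithinAt_Iio t)
    have hs : σ t ≠ 0 := ne_zero_pow two_ne_zero (hdiff.σ_sq_pos t htI).ne'
    have hW := (wronskian_pos hfund htI).ne'
    rw [hl, hkt.deriv, hmt.deriv, weight]
    simp only [m]
    field_simp
    ring
  have hrhs := ((hkD hD₁).sub (hmD h₁ hD₁)).sub ((hkD hD₂).sub (hmD h₂ hD₂))
  obtain ⟨hneg, heq⟩ := lopIntegral_eq (h := fun s => 2 * weight σ φ ψ f s) hdiff.measurable_b
    hdiff.measurable_σ hdisc.measurable h₁ h₂ measurableSet_Ioc hIoc (hparts h₁ hD₁).1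
    (hparts h₂ hD₂).1 (hrhs.congr hae.symm)
  refine ⟨hneg, ?_⟩
  rw [heq, (hparts h₁ hD₁).2, (hparts h₂ hD₂).2, integral_congr_ae hae,
    integral_sub (by exact (hkD hD₁).sub (hmD h₁ hD₁)) (by exact (hkD hD₂).sub (hmD h₂ hD₂)),
    integral_sub (hkD hD₁) (hmD h₁ hD₁), integral_sub (hkD hD₂) (hmD h₂ hD₂)]
  simp only [← intervalIntegral.integral_of_le hyz.le]
  rw [hD₁.integral_deriv_mul_add hy hz hmac, hD₂.integral_deriv_mul_add hy hz hmac]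
  simp only [coef, k, m, div_eq_mul_inv]
  ring

lemma weight_pos {α β : EReal} {b σ r φ ψ f : ℝ → ℝ} (hdiff : DiffusionCoefficients α β b σ)
    (hfund : FundamentalSolutions α β b σ r φ ψ) {x : ℝ} (hx : x ∈ interval α β)
    (hf : 0 < f x) : 0 < weight σ φ ψ f x :=
  div_pos hf (mul_pos (hdiff.σ_sq_pos x hx) (wronskian_pos hfund hx))

lemma outer_subset_interval (α β : EReal) (xl xr : ℝ) : outer α β xl xr ⊆ interval α β :=
  union_subset inter_subset_left inter_subset_left

lemma ratio_pos {α β : EReal} {b σ r φ ψ : ℝ → ℝ}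
    (hfund : FundamentalSolutions α β b σ r φ ψ) {x : ℝ} (hx : x ∈ interval α β) :
    0 < φ x / ψ x :=
  div_pos (hfund.φ_pos x hx) (hfund.ψ_pos x hx)

lemma strictAntiOn_ratio {α β : EReal} {b σ r φ ψ : ℝ → ℝ}
    (hfund : FundamentalSolutions α β b σ r φ ψ) :
    StrictAntiOn (fun x => φ x / ψ x) (interval α β) := by
  have hconv : Convex ℝ (interval α β) := (ordConnected_interval α β).convex
  have hint := (isOpen_interval α β).interior_eq
  have hφ : StrictAntiOn φ (interval α β) :=
    strictAntiOn_of_deriv_neg hconv hfund.solves_φ.continuousOn fun x hx =>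
      hfund.φ_deriv_neg x (by rwa [hint] at hx)
  have hψ : StrictMonoOn ψ (interval α β) :=
    strictMonoOn_of_deriv_pos hconv hfund.solves_ψ.continuousOn fun x hx =>
      hfund.ψ_deriv_pos x (by rwa [hint] at hx)
  intro x hx y hy hxy
  exact div_lt_div₀ (hφ hx hy hxy) (hψ hx hy hxy).le (hfund.φ_pos x hx).le (hfund.ψ_pos x hx)

section Outer

variable {α β : EReal} {b σ r φ ψ g₁ g₂ : ℝ → ℝ} {xl xr : ℝ}

lemma lopIntegral_eq_neg (hpos : lopPos α β b σ r g₁ g₂ (outer α β xl xr) = 0) {S : Set ℝ}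
    (hS : S ⊆ outer α β xl xr) (h : ℝ → ℝ) :
    lopIntegral α β b σ r g₁ g₂ h S = -∫ s in S, h s ∂(lopNeg α β b σ r g₁ g₂) := by
  rw [lopIntegral, Measure.restrict_eq_zero.2 (measure_mono_null hS hpos), integral_zero_measure,
    zero_sub]

lemma lopIntegral_congr {S T : Set ℝ} (h : ℝ → ℝ)
    (hST : ∀ᵐ x ∂(lopVar α β b σ r g₁ g₂), x ∈ S ↔ x ∈ T) :
    lopIntegral α β b σ r g₁ g₂ h S = lopIntegral α β b σ r g₁ g₂ h T := by
  rw [lopVar, ae_add_measure_iff] at hST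
  rw [lopIntegral, lopIntegral, setIntegral_congr_set (eventuallyEq_set.2 hST.1),
    setIntegral_congr_set (eventuallyEq_set.2 hST.2)]

lemma ae_ne_of_measure_singleton {μ : Measure ℝ} {c : ℝ} (h : μ {c} = 0) : ∀ᵐ x ∂μ, x ≠ c := by
  rw [ae_iff]
  simpa using h

lemma qOpen_eq_lopIntegral_Ioc {y z : ℝ} (f : ℝ → ℝ)
    (hz : lopVar α β b σ r g₁ g₂ {z} = 0) :
    qOpen α β b σ r g₁ g₂ φ ψ f y z =
      lopIntegral α β b σ r g₁ g₂ (fun s => 2 * weight σ φ ψ f s) (Ioc y z) := by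
  refine lopIntegral_congr _ ?_
  filter_upwards [ae_ne_of_measure_singleton hz] with x hx
  exact ⟨fun h => Ioo_subset_Ioc_self h, fun h => ⟨h.1, lt_of_le_of_ne h.2 hx⟩⟩

lemma qClosed_eq_lopIntegral_Ioc {y z : ℝ} (f : ℝ → ℝ)
    (hy : lopVar α β b σ r g₁ g₂ {y} = 0) :
    qClosed α β b σ r g₁ g₂ φ ψ f y z =
      lopIntegral α β b σ r g₁ g₂ (fun s => 2 * weight σ φ ψ f s) (Ioc y z) := by
  refine lopIntegral_congr _ ?_
  filter_upwards [ae_ne_of_measure_singleton hy] with x hx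
  exact ⟨fun h => ⟨lt_of_le_of_ne h.1 hx.symm, h.2⟩, fun h => Ioc_subset_Icc_self h⟩

variable {D₁ D₂ : ℝ → ℝ}

lemma boundarySystem_iff (hdiff : DiffusionCoefficients α β b σ) (hdisc : DiscountRate α β σ r)
    (hfund : FundamentalSolutions α β b σ r φ ψ)
    (h₁ : ConvexOn ℝ (interval α β) g₁) (h₂ : ConvexOn ℝ (interval α β) g₂)
    (hD₁ : IsSlope α β g₁ D₁) (hD₂ : IsSlope α β g₂ D₂) {y z : ℝ}
    (hy : y ∈ interval α β) (hz : z ∈ interval α β) (hyz : y < z)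
    (hy0 : lopVar α β b σ r g₁ g₂ {y} = 0) (hz0 : lopVar α β b σ r g₁ g₂ {z} = 0) :
    BoundarySystem α β b σ r g₁ g₂ φ ψ y z ↔
      -coef φ ψ ψ (fun t => g₁ t - g₂ t) (fun t => D₁ t - D₂ t) y =
        -coef φ ψ ψ (fun t => g₁ t - g₂ t) (fun t => D₁ t - D₂ t) z ∧
      coef φ ψ φ (fun t => g₁ t - g₂ t) (fun t => D₁ t - D₂ t) y =
        coef φ ψ φ (fun t => g₁ t - g₂ t) (fun t => D₁ t - D₂ t) z := by
  have hφ := (lopIntegral_weight_Ioc hdiff hdisc hfund hfund.solves_φ h₁ h₂ hD₁ hD₂ hy hz hyz).2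
  have hψ := (lopIntegral_weight_Ioc hdiff hdisc hfund hfund.solves_ψ h₁ h₂ hD₁ hD₂ hy hz hyz).2
  rw [BoundarySystem, qOpen_eq_lopIntegral_Ioc φ hz0, qOpen_eq_lopIntegral_Ioc ψ hz0,
    qClosed_eq_lopIntegral_Ioc φ hy0, qClosed_eq_lopIntegral_Ioc ψ hy0, hφ, hψ]
  constructor
  · rintro ⟨h1, h2, h3, h4⟩
    constructor <;> linarith
  · rintro ⟨h1, h2⟩
    refine ⟨?_, ?_, ?_, ?_⟩ <;> linarith

lemma chordRel_coef (hdiff : DiffusionCoefficients α β b σ) (hdisc : DiscountRate α β σ r)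
    (hfund : FundamentalSolutions α β b σ r φ ψ)
    (h₁ : ConvexOn ℝ (interval α β) g₁) (h₂ : ConvexOn ℝ (interval α β) g₂)
    (hD₁ : IsSlope α β g₁ D₁) (hD₂ : IsSlope α β g₂ D₂)
    (hpos : lopPos α β b σ r g₁ g₂ (outer α β xl xr) = 0)
    (hneg : ∀ c d : ℝ, c < d → Ioo c d ⊆ outer α β xl xr →
      0 < lopNeg α β b σ r g₁ g₂ (Ioo c d)) {x y : ℝ}
    (hx : x ∈ interval α β) (hy : y ∈ interval α β) (hxy : x < y)
    (hsub : Ioc x y ⊆ outer α β xl xr) :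
    ChordRel (fun t => -coef φ ψ ψ (fun t => g₁ t - g₂ t) (fun t => D₁ t - D₂ t) t)
      (fun t => coef φ ψ φ (fun t => g₁ t - g₂ t) (fun t => D₁ t - D₂ t) t)
      (fun t => φ t / ψ t) x y := by
  obtain ⟨hiφ, hφ⟩ :=
    lopIntegral_weight_Ioc hdiff hdisc hfund hfund.solves_φ h₁ h₂ hD₁ hD₂ hx hy hxy
  obtain ⟨hiψ, hψ⟩ :=
    lopIntegral_weight_Ioc hdiff hdisc hfund hfund.solves_ψ h₁ h₂ hD₁ hD₂ hx hy hxy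
  rw [lopIntegral_eq_neg hpos hsub] at hφ hψ
  have hI : Ioc x y ⊆ interval α β := hsub.trans (outer_subset_interval α β xl xr)
  have hanti := strictAntiOn_ratio hfund
  have hpw : ∀ s ∈ Ioc x y,
      2 * weight σ φ ψ φ s = φ s / ψ s * (2 * weight σ φ ψ ψ s) := by
    intro s hs
    have := (hfund.ψ_pos s (hI hs)).ne'
    simp only [weight]
    field_simp
  have hψpos : 0 < ∫ s in Ioc x y, 2 * weight σ φ ψ ψ s ∂(lopNeg α β b σ r g₁ g₂) := by
    rw [setIntegral_pos_iff_support_of_nonneg_ae _ hiψ]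
    · refine (hneg x y hxy (Ioo_subset_Ioc_self.trans hsub)).trans_le (measure_mono fun s hs => ?_)
      have hs' := Ioo_subset_Ioc_self hs
      exact ⟨(mul_pos two_pos (weight_pos hdiff hfund (hI hs') (hfund.ψ_pos s (hI hs')))).ne', hs'⟩
    · filter_upwards [ae_restrict_mem measurableSet_Ioc] with s hs
      exact (mul_pos two_pos (weight_pos hdiff hfund (hI hs) (hfund.ψ_pos s (hI hs)))).le
  have hlow : φ y / ψ y * ∫ s in Ioc x y, 2 * weight σ φ ψ ψ s ∂(lopNeg α β b σ r g₁ g₂) ≤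
      ∫ s in Ioc x y, 2 * weight σ φ ψ φ s ∂(lopNeg α β b σ r g₁ g₂) := by
    rw [← integral_const_mul]
    refine setIntegral_mono_on (hiψ.const_mul _) hiφ measurableSet_Ioc fun s hs => ?_
    rw [hpw s hs]
    refine mul_le_mul_of_nonneg_right (hanti.antitoneOn (hI hs) hy hs.2) ?_
    exact (mul_pos two_pos (weight_pos hdiff hfund (hI hs) (hfund.ψ_pos s (hI hs)))).le
  have hup : ∫ s in Ioc x y, 2 * weight σ φ ψ φ s ∂(lopNeg α β b σ r g₁ g₂) ≤
      φ x / ψ x * ∫ s in Ioc x y, 2 * weight σ φ ψ ψ s ∂(lopNeg α β b σ r g₁ g₂) := by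
    rw [← integral_const_mul]
    refine setIntegral_mono_on hiφ (hiψ.const_mul _) measurableSet_Ioc fun s hs => ?_
    rw [hpw s hs]
    refine mul_le_mul_of_nonneg_right (hanti hx (hI hs) hs.1).le ?_
    exact (mul_pos two_pos (weight_pos hdiff hfund (hI hs) (hfund.ψ_pos s (hI hs)))).le
  have eψ := neg_eq_iff_eq_neg.1 hψ
  have eφ := neg_eq_iff_eq_neg.1 hφ
  refine ⟨by linarith, hanti hx hy hxy, ratio_pos hfund hy, ?_, ?_⟩
  · calc _ = φ y / ψ y * ∫ s in Ioc x y, 2 * weight σ φ ψ ψ s ∂(lopNeg α β b σ r g₁ g₂) := by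
          rw [eψ]; ring
      _ ≤ _ := hlow
      _ = _ := by rw [eφ]; ring
  · calc _ = ∫ s in Ioc x y, 2 * weight σ φ ψ φ s ∂(lopNeg α β b σ r g₁ g₂) := by
          rw [eφ]; ring
      _ ≤ _ := hup
      _ = _ := by rw [eψ]; ring

lemma continuousAt_coef {f : ℝ → ℝ} (hdiff : DiffusionCoefficients α β b σ)
    (hdisc : DiscountRate α β σ r)
    (hfund : FundamentalSolutions α β b σ r φ ψ) (hf : SolvesODE α β b σ r f)
    (h₁ : ConvexOn ℝ (interval α β) g₁) (h₂ : ConvexOn ℝ (interval α β) g₂)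
    (hD₁ : IsSlope α β g₁ D₁) (hD₂ : IsSlope α β g₂ D₂)
    (hnonatomic : ∀ c ∈ outer α β xl xr, lopVar α β b σ r g₁ g₂ {c} = 0)
    (hpos : lopPos α β b σ r g₁ g₂ (outer α β xl xr) = 0) {x : ℝ}
    (hx : x ∈ outer α β xl xr) :
    ContinuousAt (coef φ ψ f (fun t => g₁ t - g₂ t) (fun t => D₁ t - D₂ t)) x := by
  have hopen : IsOpen (outer α β xl xr) :=
    ((isOpen_interval α β).inter isOpen_Iio).union ((isOpen_interval α β).inter isOpen_Ioi)
  obtain ⟨l, u, hlu, hsub⟩ := mem_nhds_iff_exists_Ioo_subset.1 (hopen.mem_nhds hx)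
  obtain ⟨l', hl'⟩ := exists_between hlu.1
  obtain ⟨u', hu'⟩ := exists_between hlu.2
  have hsub' : Icc l' u' ⊆ outer α β xl xr := fun t ht =>
    hsub ⟨hl'.1.trans_le ht.1, ht.2.trans_lt hu'.2⟩
  have hlu' : l' < u' := hl'.2.trans hu'.1
  have hI : ∀ t ∈ Icc l' u', t ∈ interval α β := fun t ht =>
    outer_subset_interval α β xl xr (hsub' ht)
  have hl'I := hI l' (left_mem_Icc.2 hlu'.le)
  have hform : ∀ t ∈ Icc l' u', coef φ ψ f (fun t => g₁ t - g₂ t) (fun t => D₁ t - D₂ t) t =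
      coef φ ψ f (fun t => g₁ t - g₂ t) (fun t => D₁ t - D₂ t) l' -
        ∫ s in l'..t, 2 * weight σ φ ψ f s ∂(lopNeg α β b σ r g₁ g₂) := by
    intro t ht
    rcases ht.1.eq_or_lt with rfl | hlt
    · simp
    · have h := (lopIntegral_weight_Ioc hdiff hdisc hfund hf h₁ h₂ hD₁ hD₂ hl'I (hI t ht) hlt).2
      rw [lopIntegral_eq_neg hpos
        ((Ioc_subset_Icc_self.trans (Icc_subset_Icc_right ht.2)).trans hsub')] at h
      rw [intervalIntegral.integral_of_le ht.1]
      linarith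
  have hint := (lopIntegral_weight_Ioc hdiff hdisc hfund hf h₁ h₂ hD₁ hD₂ hl'I
    (hI u' (right_mem_Icc.2 hlu'.le)) hlu').1
  have hatom : lopNeg α β b σ r g₁ g₂ {x} = 0 := by
    have := hnonatomic x hx
    rw [lopVar, Measure.add_apply, add_eq_zero] at this
    exact this.2
  have hcont := intervalIntegral.continuousWithinAt_primitive (a := l') (b₁ := l') (b₂ := u')
    (f := fun s => 2 * weight σ φ ψ f s) hatom (by
      rw [min_self, max_eq_right hlu'.le]
      exact (intervalIntegrable_iff_integrableOn_Ioc_of_le hlu'.le).2 hint)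
  have hnhds : Icc l' u' ∈ 𝓝 x := Icc_mem_nhds hl'.2 hu'.1
  refine ((continuousAt_const (y := coef φ ψ f (fun t => g₁ t - g₂ t)
    (fun t => D₁ t - D₂ t) l')).sub (hcont.continuousAt hnhds)).congr ?_
  filter_upwards [hnhds] with t ht
  exact (hform t ht).symm

end Outer

/-- A function is the combination of the fundamental solutions given by its coefficients. -/
lemma coef_combination {α β : EReal} {b σ r φ ψ g D : ℝ → ℝ}
    (hfund : FundamentalSolutions α β b σ r φ ψ) {x : ℝ} (hx : x ∈ interval α β) :
    -coef φ ψ ψ g D x * φ x + coef φ ψ φ g D x * ψ x = g x := by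
  have hW := (wronskian_pos hfund hx).ne'
  rw [coef, coef]
  field_simp
  rw [wronskian]
  ring

lemma tendsto_coef {α β : EReal} {b σ r φ ψ f g D : ℝ → ℝ} {l : Filter ℝ} {x m : ℝ}
    (hfund : FundamentalSolutions α β b σ r φ ψ) (hf : SolvesODE α β b σ r f)
    (hg : ContinuousOn g (interval α β)) (hx : x ∈ interval α β) (hl : l ≤ 𝓝 x)
    (hD : Tendsto D l (𝓝 m)) :
    Tendsto (coef φ ψ f g D) l (𝓝 ((f x * m - deriv f x * g x) / wronskian φ ψ x)) := by
  have hnhds := (isOpen_interval α β).mem_nhds hx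
  have aux : ∀ {h : ℝ → ℝ}, ContinuousOn h (interval α β) → Tendsto h l (𝓝 (h x)) :=
    fun hh => (hh.continuousAt hnhds).mono_left hl
  exact (((aux hf.continuousOn).mul hD).sub ((aux hf.continuousOn_deriv).mul (aux hg))).div
    (aux (continuousOn_wronskian hfund)) (wronskian_pos hfund hx).ne'

/-- A stationary point of `g / f` is a point of differentiability of `g`. -/
lemma hasDerivAt_of_hasDerivAt_div_zero {α β : EReal} {b σ r f g : ℝ → ℝ} {x : ℝ}
    (hf : SolvesODE α β b σ r f) (hpos : ∀ x ∈ interval α β, 0 < f x) (hx : x ∈ interval α β)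
    (h : HasDerivAt (fun x => g x / f x) 0 x) : HasDerivAt g (g x / f x * deriv f x) x := by
  have := h.mul (hf.hasDerivAt hx)
  rw [zero_mul, zero_add] at this
  refine this.congr_of_eventuallyEq ?_
  filter_upwards [(isOpen_interval α β).mem_nhds hx] with t ht
  exact (div_mul_cancel₀ _ (hpos t ht).ne').symm

lemma exists_gt_eventually_lt {l : Filter ℝ} {u : ℝ → ℝ} {q : ℝ} {L : EReal}
    (hu : Tendsto (fun x => (u x : EReal)) l (𝓝 L)) (hq : (q : EReal) < L) :
    ∃ c, q < c ∧ ∀ᶠ x in l, c < u x := by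
  obtain ⟨c, hqc, hcL⟩ := EReal.lt_iff_exists_real_btwn.1 hq
  exact ⟨c, EReal.coe_lt_coe_iff.1 hqc,
    (hu.eventually_const_lt hcL).mono fun x hx => EReal.coe_lt_coe_iff.1 hx⟩

end Straddle

theorem lemmaA1 (α β : EReal) (b σ r φ ψ g g₁ g₂ : ℝ → ℝ) (xl xr xφ xψ : ℝ) (Lα Lβ : EReal)
    (hdiff : Straddle.DiffusionCoefficients α β b σ)
    (hdisc : Straddle.DiscountRate α β σ r)
    (hfund : Straddle.FundamentalSolutions α β b σ r φ ψ)
    (hg : Straddle.Payoff α β b σ r g₁ g₂ φ ψ g)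
    (hxl : xl ∈ Straddle.interval α β) (hxr : xr ∈ Straddle.interval α β) (hlr : xl ≤ xr)
    (hnonatomic : ∀ c ∈ Straddle.outer α β xl xr, Straddle.lopVar α β b σ r g₁ g₂ {c} = 0)
    (hpos : Straddle.lopPos α β b σ r g₁ g₂ (Straddle.outer α β xl xr) = 0)
    (hneg : ∀ c d : ℝ, c < d → Set.Ioo c d ⊆ Straddle.outer α β xl xr →
      0 < Straddle.lopNeg α β b σ r g₁ g₂ (Set.Ioo c d))
    (hxφ : xφ ∈ Straddle.interval α β) (hxφl : xφ ≤ xl)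
    (hφstat : HasDerivAt (fun x => g x / φ x) 0 xφ)
    (hxψ : xψ ∈ Straddle.interval α β) (hrxψ : xr ≤ xψ)
    (hψstat : HasDerivAt (fun x => g x / ψ x) 0 xψ)
    (hLα : Filter.Tendsto (fun x => ((g x / ψ x : ℝ) : EReal)) (Straddle.downTo α) (nhds Lα))
    (hcrossα : ((g xψ / ψ xψ : ℝ) : EReal) < Lα)
    (hLβ : Filter.Tendsto (fun x => ((g x / φ x : ℝ) : EReal)) (Straddle.upTo β) (nhds Lβ))
    (hcrossβ : ((g xφ / φ xφ : ℝ) : EReal) < Lβ) :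
    ∃ a b' : ℝ, a ∈ Straddle.interval α β ∧ a < xl ∧ xr < b' ∧ b' ∈ Straddle.interval α β ∧
      Straddle.BoundarySystem α β b σ r g₁ g₂ φ ψ a b' ∧
      ∀ y z : ℝ, y ∈ Straddle.outer α β xl xr → z ∈ Straddle.outer α β xl xr → y < z →
        Straddle.BoundarySystem α β b σ r g₁ g₂ φ ψ y z → y = a ∧ z = b' := by
  open Straddle in
  have h₁ := hg.convex₁
  have h₂ := hg.convex₂
  obtain ⟨D₁, hD₁⟩ := exists_isSlope h₁
  obtain ⟨D₂, hD₂⟩ := exists_isSlope h₂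
  have := downTo_neBot hxφ
  have := upTo_neBot hxφ
  have hgcont : ContinuousOn (fun t => g₁ t - g₂ t) (interval α β) :=
    h₁.continuousOn_interval.sub h₂.continuousOn_interval
  have hchord : ∀ x ∈ interval α β, ∀ y ∈ interval α β, x < y →
      Ioc x y ⊆ outer α β xl xr → ChordRel
      (fun t => -coef φ ψ ψ (fun t => g₁ t - g₂ t) (fun t => D₁ t - D₂ t) t)
      (fun t => coef φ ψ φ (fun t => g₁ t - g₂ t) (fun t => D₁ t - D₂ t) t)
      (fun t => φ t / ψ t) x y := fun x hx y hy hxy hsub =>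
    chordRel_coef hdiff hdisc hfund h₁ h₂ hD₁ hD₂ hpos hneg hx hy hxy hsub
  have hcA : ContinuousOn
      (fun t => -coef φ ψ ψ (fun t => g₁ t - g₂ t) (fun t => D₁ t - D₂ t) t)
      (outer α β xl xr) := fun x hx =>
    (continuousAt_coef hdiff hdisc hfund hfund.solves_ψ h₁ h₂ hD₁ hD₂ hnonatomic hpos
      hx).neg.continuousWithinAt
  have hcB : ContinuousOn
      (fun t => coef φ ψ φ (fun t => g₁ t - g₂ t) (fun t => D₁ t - D₂ t) t)
      (outer α β xl xr) := fun x hx =>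
    (continuousAt_coef hdiff hdisc hfund hfund.solves_φ h₁ h₂ hD₁ hD₂ hnonatomic hpos
      hx).continuousWithinAt
  have hcombφ : ∀ x ∈ interval α β,
      -coef φ ψ ψ (fun t => g₁ t - g₂ t) (fun t => D₁ t - D₂ t) x + (φ x / ψ x)⁻¹ *
        coef φ ψ φ (fun t => g₁ t - g₂ t) (fun t => D₁ t - D₂ t) x = g x / φ x := by
    intro x hx
    have h1 := (hfund.φ_pos x hx).ne'
    rw [hg.eq_sub x hx, ← coef_combination (g := fun t => g₁ t - g₂ t)
      (D := fun t => D₁ t - D₂ t) hfund hx, inv_div]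
    field_simp
  have hcombψ : ∀ x ∈ interval α β,
      coef φ ψ φ (fun t => g₁ t - g₂ t) (fun t => D₁ t - D₂ t) x + φ x / ψ x *
        -coef φ ψ ψ (fun t => g₁ t - g₂ t) (fun t => D₁ t - D₂ t) x = g x / ψ x := by
    intro x hx
    have h1 := (hfund.ψ_pos x hx).ne'
    rw [hg.eq_sub x hx, ← coef_combination (g := fun t => g₁ t - g₂ t)
      (D := fun t => D₁ t - D₂ t) hfund hx]
    field_simp
    ring
  have hIα : ∀ᶠ x in downTo α, x ∈ interval α β :=
    (eventually_downTo hxφ).mono fun x hx => hx.1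
  have hIβ : ∀ᶠ x in upTo β, x ∈ interval α β := (eventually_upTo hxφ).mono fun x hx => hx.1
  have hu : Tendsto (fun x => g x / φ x) (downTo α) (𝓝 0) := by
    rw [tendsto_zero_iff_abs_tendsto_zero]
    refine hg.limit_α.congr' (hIα.mono fun x hx => ?_)
    rw [Function.comp_apply, abs_div, abs_of_pos (hfund.φ_pos x hx)]
  have hv : Tendsto (fun x => g x / ψ x) (upTo β) (𝓝 0) := by
    rw [tendsto_zero_iff_abs_tendsto_zero]
    refine hg.limit_β.congr' (hIβ.mono fun x hx => ?_)
    rw [Function.comp_apply, abs_div, abs_of_pos (hfund.ψ_pos x hx)]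
  obtain ⟨c, hqc, hc⟩ := exists_gt_eventually_lt hLα hcrossα
  obtain ⟨d, hpd, hd⟩ := exists_gt_eventually_lt hLβ hcrossβ
  have hmφ := slope_sub_of_hasDerivAt hD₁ hD₂ hg.eq_sub hxφ
    (hasDerivAt_of_hasDerivAt_div_zero hfund.solves_φ hfund.φ_pos hxφ hφstat)
  have hmψ := slope_sub_of_hasDerivAt hD₁ hD₂ hg.eq_sub hxψ
    (hasDerivAt_of_hasDerivAt_div_zero hfund.solves_ψ hfund.ψ_pos hxψ hψstat)
  have hDψ : Tendsto (fun t => D₁ t - D₂ t) (𝓝[>] xψ) (𝓝 (g xψ / ψ xψ * deriv ψ xψ)) := by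
    rw [← hmψ.1]
    exact (hD₁.rightCont xψ hxψ).sub (hD₂.rightCont xψ hxψ)
  obtain ⟨a, haI, b', hbI, hal, hbr, hA, hB, huniq⟩ := exists_unique_crossing
    (ordConnected_interval α β)
    (A := fun t => -coef φ ψ ψ (fun t => g₁ t - g₂ t) (fun t => D₁ t - D₂ t) t)
    (B := fun t => coef φ ψ φ (fun t => g₁ t - g₂ t) (fun t => D₁ t - D₂ t) t)
    (ρ := fun t => φ t / ψ t) (xl := xl) (xr := xr) (xφ := xφ) (xψ := xψ)
    (p := g xφ / φ xφ) (q := g xψ / ψ xψ)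
    (fun y hy => eventually_downTo hy) (fun y hy => eventually_upTo hy)
    (fun x hx => ratio_pos hfund hx) (strictAntiOn_ratio hfund)
    (fun x hx y hy hxy hyl => hchord x hx y hy hxy fun t ht =>
      Or.inl ⟨Icc_subset_interval hx hy (Ioc_subset_Icc_self ht), ht.2.trans_lt hyl⟩)
    (fun x hx y hy hrx hxy => hchord x hx y hy hxy fun t ht =>
      Or.inr ⟨Icc_subset_interval hx hy (Ioc_subset_Icc_self ht), hrx.trans ht.1⟩)
    (hcA.mono subset_union_left) (hcB.mono subset_union_left) (hcA.mono subset_union_right)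
    hxφ hxψ hlr hxφl hrxψ
    (by
      convert! (tendsto_coef hfund hfund.solves_ψ hgcont hxφ nhdsWithin_le_nhds hmφ.2).neg using 2
      have h1 := (hfund.φ_pos xφ hxφ).ne'
      have h2 := (wronskian_pos hfund hxφ).ne'
      rw [← hg.eq_sub xφ hxφ]
      field_simp
      rw [wronskian]
      ring)
    (by
      convert! tendsto_coef hfund hfund.solves_φ hgcont hxφ nhdsWithin_le_nhds hmφ.2 using 2
      have h1 := (hfund.φ_pos xφ hxφ).ne'
      rw [← hg.eq_sub xφ hxφ]
      field_simp
      ring)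
    (by
      convert! (tendsto_coef hfund hfund.solves_ψ hgcont hxψ nhdsWithin_le_nhds hDψ).neg using 2
      have h1 := (hfund.ψ_pos xψ hxψ).ne'
      rw [← hg.eq_sub xψ hxψ]
      field_simp
      ring)
    (by
      convert! tendsto_coef hfund hfund.solves_φ hgcont hxψ nhdsWithin_le_nhds hDψ using 2
      have h1 := (hfund.ψ_pos xψ hxψ).ne'
      have h2 := (wronskian_pos hfund hxψ).ne'
      rw [← hg.eq_sub xψ hxψ]
      field_simp
      rw [wronskian]
      ring)
    (hu.congr' (hIα.mono fun x hx => (hcombφ x hx).symm))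
    (hv.congr' (hIβ.mono fun x hx => (hcombψ x hx).symm))
    hqc (by filter_upwards [hc, hIα] with x hx hxI; rwa [hcombψ x hxI])
    hpd (by filter_upwards [hd, hIβ] with x hx hxI; rwa [hcombφ x hxI])
  have hab : a < b' := hal.trans_le (hlr.trans hbr.le)
  refine ⟨a, b', haI, hal, hbr, hbI, ?_, ?_⟩
  · exact (boundarySystem_iff hdiff hdisc hfund h₁ h₂ hD₁ hD₂ haI hbI hab
      (hnonatomic a (Or.inl ⟨haI, hal⟩)) (hnonatomic b' (Or.inr ⟨hbI, hbr⟩))).2 ⟨hA, hB⟩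
  · intro y z hy hz hyz hsys
    obtain ⟨h1, h2⟩ := (boundarySystem_iff hdiff hdisc hfund h₁ h₂ hD₁ hD₂
      (outer_subset_interval α β xl xr hy) (outer_subset_interval α β xl xr hz) hyz
      (hnonatomic y hy) (hnonatomic z hz)).1 hsys
    exact huniq y hy z hz hyz h1 h2
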